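/- Theorem. Let $b\ge 2$ and $m\ge 1$ be integers with $b\not\equiv 1 \pmod m$. Let $\mathbf t=\mathbf t_{b,m}$ be the infinite word over $\mathbb Z_m=\{0,1,\dots,m-1\}$ that starts with the letter $0$ and is a fixed point of the morphism $\varphi_{b,m}: k\mapsto k(k+1)\cdots(k+b-1)$ (letters modulo $m$). Let $\mathcal L(\mathbf t)$ be the set of finite factors of $\mathbf t$, and for $w\in\mathcal L(\mathbf t)$ let $$\rho(w)=\lim_{|v|\to\infty,\ v\in\mathcal L(\mathbf t)}\frac{\#\{\text{occurrences of } w \text{ in } v\}}{|v|}$$ be its frequency. Let $q$ be the least positive integer with $q(b-1)\equiv 0\pmod m$. Then $\rho(w)$ exists for every $w\in\mathcal L(\mathbf t)$, the word $01$ is a factor of $\mathbf t$, its frequency is $$f:=\rho(01)=\frac{b^{q-1}(b-1)}{m(b^q-1)},$$ and for $N\in\mathbb N=\{0,1,2,\dots\}$ the set $F_N=\{\rho(e) : e\in\mathcal L(\mathbf t),\ |e|=N+1\}$ is as follows, where $\ell$ ranges over $\{0,1,2,\dots\}$. 1. If $N=0$, then $F_N=\{\frac1m\}$. 2. If $N=1$,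 then $F_N=\{\frac{f}{b^k} : 0\le k\le q-1\}$. 3. If $(n-1)b^\ell<N<nb^\ell$ with $n\in\{3,\dots,b\}$, then $$F_N=\Bigl\{\tfrac1{b^\ell}\bigl((n-1)f-\tfrac{n-2}{m}\bigr),\ \tfrac1{b^\ell}\bigl(nf-\tfrac{n-1}{m}\bigr)\Bigr\}\cup\Bigl\{\tfrac1{b^\ell}\tfrac{f}{b^k} : 1\le k\le q-1\Bigr\}.$$ 4. If $(n-1)b^\ell<N<nb^\ell$ with $n\in\{b+1,\dots,2b-1\}$, then $$F_N=\Bigl\{\tfrac1{b^\ell}\bigl(\tfrac{f}{b^{q-1}}-\tfrac{n-b-1}{b^q}f\bigr),\ \tfrac1{b^\ell}\bigl(\tfrac{f}{b^{q-1}}-\tfrac{n-b}{b^q}f\bigr),\ \tfrac1{b^{\ell+1}}\bigl(2f-\tfrac1m\bigr)\Bigr\}\cup\Bigl\{\tfrac1{b^\ell}\tfrac{f}{b^k} : 1\le k\le q\Bigr\}.$$ 5. If $(2b-1)b^\ell<N<2b^{\ell+1}$, then $$F_N=\Bigl\{\tfrac1{b^{\ell+1}}\bigl(2f-\tfrac1m\bigr)\Bigr\}\cup\Bigl\{\tfrac1{b^{\ell+1}}\tfrac{f}{b^k}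 : 0\le k\le q-1\Bigr\}.$$ 6. If $N=nb^\ell$ with $n\in\{2,\dots,b\}$, then $$F_N=\Bigl\{\tfrac1{b^\ell}\bigl(nf-\tfrac{n-1}{m}\bigr)\Bigr\}\cup\Bigl\{\tfrac1{b^\ell}\tfrac{f}{b^k} : 1\le k\le q-1\Bigr\}.$$ 7. If $N=nb^\ell$ with $n\in\{b+1,\dots,2b-1\}$, then $$F_N=\Bigl\{\tfrac1{b^\ell}\bigl(\tfrac{f}{b^{q-1}}-\tfrac{n-b}{b^q}f\bigr),\ \tfrac1{b^{\ell+1}}\bigl(2f-\tfrac1m\bigr)\Bigr\}\cup\Bigl\{\tfrac1{b^\ell}\tfrac{f}{b^k} : 1\le k\le q\Bigr\}.$$ -/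

import Mathlib

open Filter Topology

/-- The image of the letter `k` under the generalized Thue-Morse morphism `φ_{b,m}`, namely the word
`k (k+1) … (k+b-1)` with letters taken modulo `m`. -/
def thueMorseMorphism (b m : ℕ) (k : ZMod m) : List (ZMod m) :=
  (List.range b).map fun i : ℕ => k + (i : ZMod m)

/-- The factor `u_i u_{i+1} … u_{i+n-1}` of the infinite word `u`. -/
def wordFactor {α : Type*} (u : ℕ → α) (i n : ℕ) : List α :=
  (List.range n).map fun j => u (i + j)

/-- The infinite word `u` is a fixed point of the morphism determined by the letter images `φ`:
the image of every prefix of `u` (the concatenation of the images of its letters) is again a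
prefix of `u`. -/
def IsFixedPointOf {α : Type*} (φ : α → List α) (u : ℕ → α) : Prop :=
  ∀ n : ℕ, (wordFactor u 0 n).flatMap φ = wordFactor u 0 ((wordFactor u 0 n).flatMap φ).length

/-- The language of `u`, that is, the set of all (finite) factors of `u`. -/
def language {α : Type*} (u : ℕ → α) : Set (List α) :=
  {w | ∃ i n : ℕ, w = wordFactor u i n}

/-- The number of occurrences of the word `w` in the word `v`, that is, the number of positions
at which `w` is read in `v`. -/
def occurrences {α : Type*} [DecidableEq α] (w v : List α) : ℕ :=
  ((Finset.range (v.length + 1)).filter fun i => w <+: v.drop i).card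

/-- `HasFrequency u w r`: the quotient of the number of occurrences of `w` in `v` by `|v|` tends
to `r` as `|v| → ∞`, `v` ranging over all factors of `u`. -/
def HasFrequency {α : Type*} [DecidableEq α] (u : ℕ → α) (w : List α) (r : ℝ) : Prop :=
  Tendsto (fun v : List α => (occurrences w v : ℝ) / (v.length : ℝ))
    (comap List.length atTop ⊓ 𝓟 (language u)) (𝓝 r)

/-- The set of frequencies of the factors of `u` of length `n`. -/
def frequencySet {α : Type*} [DecidableEq α] (u : ℕ → α) (n : ℕ) : Set ℝ :=
  {r | ∃ e ∈ language u, e.length = n ∧ HasFrequency u e r}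

/-- Letterwise form of the fixed point equation of the generalized Thue-Morse morphism. -/
theorem isFixedPointOf_thueMorseMorphism_iff {b m : ℕ} (u : ℕ → ZMod m) :
    IsFixedPointOf (thueMorseMorphism b m) u ↔
      ∀ k j : ℕ, j < b → u (b * k + j) = u k + (j : ZMod m) := by
  have hlen : ∀ n, ((wordFactor u 0 n).flatMap (thueMorseMorphism b m)).length = b * n := by
    intro n
    induction n with
    | zero => simp [wordFactor]
    | succ n ih =>
      simp only [wordFactor, List.range_succ, List.map_append, List.flatMap_append,
        List.length_append] at ih ⊢
      rw [ih]
      simp [thueMorseMorphism, Nat.mul_succ]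
  have hsplit : ∀ n, wordFactor u 0 (b * (n + 1)) =
      wordFactor u 0 (b * n) ++ (List.range b).map fun j => u (b * n + j) := by
    intro n
    simp [wordFactor, Nat.mul_succ, List.range_add, Function.comp_def]
  have hsplit' : ∀ n, (wordFactor u 0 (n + 1)).flatMap (thueMorseMorphism b m) =
      (wordFactor u 0 n).flatMap (thueMorseMorphism b m) ++ thueMorseMorphism b m (u n) := by
    intro n
    simp [wordFactor, List.range_succ, List.flatMap_append]
  constructor
  · intro h k j hj
    have h1 := h k
    have h2 := h (k + 1)
    rw [hlen] at h1 h2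
    rw [hsplit, hsplit', h1] at h2
    have h3 := List.append_cancel_left h2
    simp only [thueMorseMorphism] at h3
    have h4 := List.map_inj_left.1 h3 j (List.mem_range.2 hj)
    exact h4.symm
  · intro h n
    rw [hlen]
    induction n with
    | zero => simp [wordFactor]
    | succ n ih =>
      rw [hsplit, hsplit', ih]
      congr 1
      simp only [thueMorseMorphism]
      exact List.map_congr_left fun j hj => (h n j (List.mem_range.1 hj)).symm

/-- The morphism has exactly one fixed point starting in `0`. -/
theorem existsUnique_thueMorse_fixedPoint {b : ℕ} (hb : 2 ≤ b) (m : ℕ) :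
    ∃! u : ℕ → ZMod m, u 0 = 0 ∧ IsFixedPointOf (thueMorseMorphism b m) u := by
  refine ⟨fun n => ((Nat.digits b n).sum : ZMod m), ⟨by simp, ?_⟩, ?_⟩
  · rw [isFixedPointOf_thueMorseMorphism_iff]
    intro k j hj
    rcases Nat.eq_zero_or_pos (b * k + j) with h0 | h0
    · have hj0 : j = 0 := by omega
      have hk0 : k = 0 := by
        have : b * k = 0 := by omega
        rcases Nat.mul_eq_zero.1 this with h | h <;> omega
      simp [hj0, hk0]
    · have h1 : (b * k + j) % b = j := by
        rw [Nat.mul_add_mod, Nat.mod_eq_of_lt hj]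
      have h2 : (b * k + j) / b = k := by
        rw [Nat.mul_add_div (by omega), Nat.div_eq_of_lt hj, Nat.add_zero]
      show ((Nat.digits b (b * k + j)).sum : ZMod m) = ((Nat.digits b k).sum : ZMod m) + (j : ZMod m)
      rw [Nat.digits_def' (by omega) h0, h1, h2, List.sum_cons, Nat.cast_add, add_comm]
  · rintro v ⟨hv0, hv⟩
    rw [isFixedPointOf_thueMorseMorphism_iff] at hv
    funext n
    induction n using Nat.strong_induction_on with
    | _ n ih =>
      rcases Nat.eq_zero_or_pos n with rfl | hn
      · simp [hv0]
      · have h1 := hv (n / b) (n % b) (Nat.mod_lt _ (by omega))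
        rw [Nat.div_add_mod] at h1
        rw [h1, ih (n / b) (Nat.div_lt_self hn (by omega))]
        show _ = ((Nat.digits b n).sum : ZMod m)
        rw [Nat.digits_def' (by omega : 1 < b) hn, List.sum_cons, Nat.cast_add, add_comm]

/-! Frequencies are treated as uniform densities of sets of positions: averages over windows `[i, i
+ n)` with `n → ∞`, uniformly in `i`. The engine is the self-similarity `t (b * k + j) = t k + j`.
It makes the density of a set `A` the mean of the densities of its sections `{n | b * n + c ∈ A}`,
`c < b`. If `A` is the set of occurrences of a factor, each nonempty section is the set of
occurrences of a shorter factor, its ancestor.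

Inside a block of length `b` letters increase by one, so a step other than `+1` (a jump) occurs only
at a block boundary. Each step has the form `1 - k (b - 1)` with `k < q`, and passing from an
ancestor to the boundary between its image blocks replaces `k` by `k + 1` modulo `q`. Hence the
pairs with parameter `k ≥ 1` have density `f / b ^ k`, and the pairs with `k = 0` give the equation
`f = ((b - 1) / m + f / b ^ (q - 1)) / b`. Existence of these densities, and of the letter
densities, comes from a contraction argument.

For longer factors there are two cases. A factor with a jump occurs in one residue class modulo `b`
only, so its density is that of its ancestor divided by `b`. A factor without a jump is a run `a (a
+ 1) …`. Each block boundary inside a run comes from a step `+b` of the ancestor (`k = q - 1`), and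
two consecutive steps `+b` are impossible. So the density of a run is an explicit mean over
residues, and no run has `N ≥ 2 b`. The cases `N < 2 b` are computed directly
(`mem_factorDensities_of_le`, `mem_factorDensities_of_ge`). For `N ≥ 2 b` the densities are those
for `N / b` rounded down and up, divided by `b` (`mem_factorDensities_div`), which produces the
scaling by `b ^ l`. -/

/-! ### Uniform densities of sets of positions. -/

/-- The average of the indicator function of `A` over the window `[i, i + n)`, where `p = (i, n)`. -/
noncomputable def windowAvg (A : Set ℕ) (p : ℕ × ℕ) : ℝ :=
  (∑ j ∈ Finset.range p.2, A.indicator (1 : ℕ → ℝ) (p.1 + j)) / p.2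

/-- Windows whose length tends to infinity, at arbitrary positions. -/
def longWindows : Filter (ℕ × ℕ) := (⊤ : Filter ℕ) ×ˢ atTop

/-- `A` has uniform density `r`. -/
def HasDensity (A : Set ℕ) (r : ℝ) : Prop := Tendsto (windowAvg A) longWindows (𝓝 r)

/-- Over long windows, the averages of `A` differ from `r` by at most `δ` in the limit. -/
def NearDensity (A : Set ℕ) (r δ : ℝ) : Prop :=
  ∀ ε > 0, ∀ᶠ p in longWindows, |windowAvg A p - r| ≤ δ + ε

instance : longWindows.NeBot := by unfold longWindows; infer_instance

theorem tendsto_snd_longWindows : Tendsto (fun p : ℕ × ℕ => p.2) longWindows atTop := tendsto_snd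

theorem tendsto_const_div_longWindows (C : ℝ) :
    Tendsto (fun p : ℕ × ℕ => C / (p.2 : ℝ)) longWindows (𝓝 0) :=
  (tendsto_const_div_atTop_nhds_zero_nat C).comp tendsto_snd_longWindows

theorem tendsto_div_longWindows {b : ℕ} (hb : 0 < b) :
    Tendsto (fun p : ℕ × ℕ => (p.1 / b, p.2 / b)) longWindows longWindows :=
  Tendsto.prodMk tendsto_top ((Nat.tendsto_div_const_atTop hb.ne').comp tendsto_snd_longWindows)

theorem HasDensity.unique {A : Set ℕ} {r s : ℝ} (h : HasDensity A r) (h' : HasDensity A s) :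
    r = s := tendsto_nhds_unique h h'

theorem hasDensity_iff_nearDensity {A : Set ℕ} {r : ℝ} : HasDensity A r ↔ NearDensity A r 0 := by
  unfold HasDensity NearDensity
  rw [Metric.tendsto_nhds]
  simp only [Real.dist_eq, zero_add]
  constructor
  · intro h ε hε
    filter_upwards [h ε hε] with p hp using hp.le
  · intro h ε hε
    filter_upwards [h (ε / 2) (by positivity)] with p hp using by linarith

theorem indicator_one_nonneg (A : Set ℕ) (n : ℕ) : 0 ≤ A.indicator (1 : ℕ → ℝ) n :=
  Set.indicator_nonneg (by simp) n

theorem indicator_one_le (A : Set ℕ) (n : ℕ) : A.indicator (1 : ℕ → ℝ) n ≤ 1 :=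
  Set.indicator_apply_le' (by simp) (by simp)

theorem sum_indicator_range_le (A : Set ℕ) (i n : ℕ) :
    ∑ j ∈ Finset.range n, A.indicator (1 : ℕ → ℝ) (i + j) ≤ n := by
  refine (Finset.sum_le_sum fun j _ => indicator_one_le A (i + j)).trans ?_
  simp

theorem sum_indicator_range_nonneg (A : Set ℕ) (i n : ℕ) :
    0 ≤ ∑ j ∈ Finset.range n, A.indicator (1 : ℕ → ℝ) (i + j) :=
  Finset.sum_nonneg fun j _ => indicator_one_nonneg A (i + j)

theorem windowAvg_nonneg (A : Set ℕ) (p : ℕ × ℕ) : 0 ≤ windowAvg A p :=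
  div_nonneg (sum_indicator_range_nonneg A _ _) (Nat.cast_nonneg _)

theorem windowAvg_le_one (A : Set ℕ) (p : ℕ × ℕ) : windowAvg A p ≤ 1 :=
  div_le_one_of_le₀ (sum_indicator_range_le A _ _) (Nat.cast_nonneg _)

/-- Averages lie in `[0, 1]`; this crude bound starts the contraction arguments. -/
theorem nearDensity_trivial (A : Set ℕ) (r : ℝ) : NearDensity A r (1 + |r|) := by
  intro ε hε
  refine Eventually.of_forall fun p => ?_
  have h0 := windowAvg_nonneg A p
  have h1 := windowAvg_le_one A p
  have h2 := abs_sub (windowAvg A p) r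
  rw [abs_of_nonneg h0] at h2
  linarith

theorem hasDensity_empty : HasDensity ∅ 0 := by
  have : windowAvg ∅ = fun _ => 0 := by ext p; simp [windowAvg]
  rw [HasDensity, this]; exact tendsto_const_nhds

theorem hasDensity_univ : HasDensity Set.univ 1 := by
  refine tendsto_const_nhds.congr' ?_
  filter_upwards [tendsto_snd_longWindows.eventually_ge_atTop 1] with p hp
  have : (p.2 : ℝ) ≠ 0 := by exact_mod_cast (show p.2 ≠ 0 by omega)
  simp [windowAvg, this]

/-- The sum over a window and the sum over the window enlarged or cut down to multiples of `b`
differ by at most `2 b`. -/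
theorem abs_sum_window_sub_le {b : ℕ} (hb : 0 < b) (A : Set ℕ) (i n : ℕ) :
    |∑ j ∈ Finset.range n, A.indicator (1 : ℕ → ℝ) (i + j) -
      ∑ j ∈ Finset.range (b * (n / b)), A.indicator (1 : ℕ → ℝ) (b * (i / b) + j)| ≤ 2 * b := by
  set g := A.indicator (1 : ℕ → ℝ) with hg
  have key : ∀ i n : ℕ, ∑ j ∈ Finset.range n, g (i + j) =
      ∑ j ∈ Finset.range (i + n), g j - ∑ j ∈ Finset.range i, g j := by
    intro i n; rw [Finset.sum_range_add]; ring
  have mono : ∀ k l u : ℕ, k ≤ l → l ≤ k + u →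
      0 ≤ ∑ j ∈ Finset.range l, g j - ∑ j ∈ Finset.range k, g j ∧
      ∑ j ∈ Finset.range l, g j - ∑ j ∈ Finset.range k, g j ≤ u := by
    intro k l u h1 h2
    obtain ⟨d, rfl⟩ := Nat.exists_eq_add_of_le h1
    rw [← key]
    refine ⟨sum_indicator_range_nonneg A k d, (sum_indicator_range_le A k d).trans ?_⟩
    exact_mod_cast (show d ≤ u by omega)
  rw [key, key]
  have hi := Nat.div_add_mod i b
  have hn := Nat.div_add_mod n b
  have hi' := Nat.mod_lt i hb
  have hn' := Nat.mod_lt n hb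
  have h1 := mono (b * (i / b)) i b (by omega) (by omega)
  have h2 := mono (b * (i / b) + b * (n / b)) (i + n) (2 * b) (by omega) (by omega)
  push_cast at h2
  have : (0 : ℝ) ≤ b := Nat.cast_nonneg b
  rw [abs_le]; constructor <;> linarith [h1.1, h1.2, h2.1, h2.2]

theorem sum_range_mul_eq (b : ℕ) (g : ℕ → ℝ) (i n : ℕ) :
    ∑ j ∈ Finset.range (b * n), g (b * i + j) =
      ∑ c ∈ Finset.range b, ∑ j ∈ Finset.range n, g (b * (i + j) + c) := by
  rw [Finset.sum_comm]
  induction n with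
  | zero => simp
  | succ n ih =>
    rw [Nat.mul_succ, Finset.sum_range_add, ih, Finset.sum_range_succ]
    congr 1
    exact Finset.sum_congr rfl fun c _ => by congr 1; ring

/-- Averages over a long window are averages of the averages over the residue classes. -/
theorem tendsto_windowAvg_sub {b : ℕ} (hb : 0 < b) (A : Set ℕ) :
    Tendsto (fun p : ℕ × ℕ => windowAvg A p -
      (∑ c ∈ Finset.range b, windowAvg {n | b * n + c ∈ A} (p.1 / b, p.2 / b)) / b)
      longWindows (𝓝 0) := by
  refine squeeze_zero_norm' ?_ (tendsto_const_div_longWindows (3 * b))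
  filter_upwards [tendsto_snd_longWindows.eventually_ge_atTop b] with p hp
  obtain ⟨i, n⟩ := p
  simp only at hp ⊢
  have hn0 : (0 : ℝ) < n := by exact_mod_cast (show 0 < n by omega)
  have hb0 : (0 : ℝ) < b := by exact_mod_cast hb
  have hk : 0 < n / b := Nat.div_pos hp hb
  have hk0 : (0 : ℝ) < ((n / b : ℕ) : ℝ) := by exact_mod_cast hk
  have e : (∑ c ∈ Finset.range b, windowAvg {n | b * n + c ∈ A} (i / b, n / b)) / b =
      (∑ j ∈ Finset.range (b * (n / b)), A.indicator (1 : ℕ → ℝ) (b * (i / b) + j)) /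
        (b * (n / b : ℕ) : ℝ) := by
    rw [sum_range_mul_eq]
    simp only [windowAvg]
    rw [← Finset.sum_div, div_div, mul_comm (b : ℝ)]
    rfl
  rw [e, windowAvg]
  have h1 := abs_sum_window_sub_le hb A i n
  have h2 := sum_indicator_range_le A (b * (i / b)) (b * (n / b))
  have h3 := sum_indicator_range_nonneg A (b * (i / b)) (b * (n / b))
  push_cast at h2
  simp only
  generalize ∑ j ∈ Finset.range n, A.indicator (1 : ℕ → ℝ) (i + j) = S at *
  generalize ∑ j ∈ Finset.range (b * (n / b)), A.indicator (1 : ℕ → ℝ) (b * (i / b) + j) = S' at *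
  have h4 : (b : ℝ) * (n / b : ℕ) ≤ n := by exact_mod_cast Nat.mul_div_le n b
  have h5 : (n : ℝ) ≤ (b : ℝ) * (n / b : ℕ) + b := by
    have := Nat.div_add_mod n b
    have := Nat.mod_lt n hb
    exact_mod_cast (show n ≤ b * (n / b) + b by omega)
  set K : ℝ := (b : ℝ) * (n / b : ℕ) with hK
  have hK0 : 0 < K := by positivity
  have e2 : S / n - S' / K = ((S - S') - S' / K * (n - K)) / n := by field_simp; ring
  have h6 : S' / K ≤ 1 := div_le_one_of_le₀ h2 hK0.le
  have h7 : 0 ≤ S' / K := by positivity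
  rw [e2, Real.norm_eq_abs, abs_div, abs_of_pos hn0]
  gcongr
  rw [abs_le] at h1 ⊢
  constructor <;> nlinarith [h1.1, h1.2]

/-- Errors average along with densities: sections of exactly known density contribute no error, and
this is where contraction comes from. -/
theorem NearDensity.split {b : ℕ} (hb : 0 < b) {A : Set ℕ} {r δ : ℕ → ℝ}
    (h : ∀ c < b, NearDensity {n | b * n + c ∈ A} (r c) (δ c)) :
    NearDensity A ((∑ c ∈ Finset.range b, r c) / b) ((∑ c ∈ Finset.range b, δ c) / b) := by
  intro ε hε
  have hb0 : (0 : ℝ) < b := by exact_mod_cast hb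
  have h1 : ∀ᶠ p in longWindows, ∀ c ∈ Finset.range b,
      |windowAvg {n | b * n + c ∈ A} (p.1 / b, p.2 / b) - r c| ≤ δ c + ε / 2 := by
    rw [Filter.eventually_all_finset]
    intro c hc
    exact (tendsto_div_longWindows hb).eventually (h c (Finset.mem_range.1 hc) (ε / 2) (by positivity))
  have h2 := (Metric.tendsto_nhds.1 (tendsto_windowAvg_sub hb A)) (ε / 2) (by positivity)
  filter_upwards [h1, h2] with p hp hp2
  rw [Real.dist_eq, sub_zero] at hp2
  have h3 : |∑ c ∈ Finset.range b, windowAvg {n | b * n + c ∈ A} (p.1 / b, p.2 / b) -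
      ∑ c ∈ Finset.range b, r c| ≤ ∑ c ∈ Finset.range b, δ c + b * (ε / 2) := by
    rw [← Finset.sum_sub_distrib]
    refine (Finset.abs_sum_le_sum_abs _ _).trans ((Finset.sum_le_sum hp).trans ?_)
    rw [Finset.sum_add_distrib]; simp
  generalize ∑ c ∈ Finset.range b, windowAvg {n | b * n + c ∈ A} (p.1 / b, p.2 / b) = S at *
  generalize windowAvg A p = x at *
  calc |x - (∑ c ∈ Finset.range b, r c) / b|
      = |(x - S / b) + (S - ∑ c ∈ Finset.range b, r c) / b| := by congr 1; ring
    _ ≤ |x - S / b| + |(S - ∑ c ∈ Finset.range b, r c) / b| := abs_add_le _ _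
    _ ≤ ε / 2 + (∑ c ∈ Finset.range b, δ c + b * (ε / 2)) / b := by
        rw [abs_div, abs_of_pos hb0]; gcongr
    _ = _ := by field_simp; ring

theorem HasDensity.split {b : ℕ} (hb : 0 < b) {A : Set ℕ} {r : ℕ → ℝ}
    (h : ∀ c < b, HasDensity {n | b * n + c ∈ A} (r c)) :
    HasDensity A ((∑ c ∈ Finset.range b, r c) / b) := by
  rw [hasDensity_iff_nearDensity]
  have := NearDensity.split (δ := fun _ => 0) hb fun c hc => hasDensity_iff_nearDensity.1 (h c hc)
  simpa using this

/-- A set contained in one residue class modulo `b`. -/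
theorem HasDensity.of_residue {b c : ℕ} (hc : c < b) {A : Set ℕ} (hA : ∀ i ∈ A, i % b = c) {r : ℝ}
    (h : HasDensity {n | b * n + c ∈ A} r) : HasDensity A (r / b) := by
  have := HasDensity.split (b := b) (by omega) (A := A) (r := fun c' => if c' = c then r else 0) ?_
  · simpa [hc] using this
  · intro c' hc'
    by_cases h' : c' = c
    · subst h'; simpa using h
    · have : {n | b * n + c' ∈ A} = ∅ := by
        ext n
        simp only [Set.mem_ofPred_eq, Set.mem_empty_iff_false, iff_false]
        intro hn
        have := hA _ hn
        rw [Nat.mul_add_mod, Nat.mod_eq_of_lt hc'] at this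
        exact h' this
      rw [this]; simpa [h'] using hasDensity_empty

/-- The error bound drops to `θ ^ k * C` after `k` steps, so the limits exist without being assumed
to. The whole family is treated at once because the sections of one member involve the others. -/
theorem hasDensity_of_contraction {ι : Type*} {A : ι → Set ℕ} {r : ι → ℝ} {C θ : ℝ}
    (h0 : ∀ a, NearDensity (A a) (r a) C) (hθ : 0 ≤ θ) (hθ1 : θ < 1)
    (step : ∀ δ, (∀ a, NearDensity (A a) (r a) δ) → ∀ a, NearDensity (A a) (r a) (θ * δ)) (a : ι) :
    HasDensity (A a) (r a) := by
  have hk : ∀ k : ℕ, ∀ a, NearDensity (A a) (r a) (θ ^ k * C) := by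
    intro k
    induction k with
    | zero => simpa using h0
    | succ k ih => simpa [pow_succ', mul_assoc] using step _ ih
  rw [hasDensity_iff_nearDensity]
  intro ε hε
  have hlim : Tendsto (fun k : ℕ => θ ^ k * C) atTop (𝓝 0) := by
    simpa using (tendsto_pow_atTop_nhds_zero_of_lt_one hθ hθ1).mul_const C
  obtain ⟨k, hk'⟩ := (hlim.eventually_lt_const (show 0 < ε / 2 by positivity)).exists
  filter_upwards [hk k a (ε / 2) (by positivity)] with p hp
  linarith

/-! ### Densities of letters and of pairs of letters. -/

section ThueMorse

variable {b m : ℕ} {t : ℕ → ZMod m}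

theorem block_apply (H : ∀ k j, j < b → t (b * k + j) = t k + j) (ht0 : t 0 = 0) (hb : 2 ≤ b)
    (L k j : ℕ) (hj : j < b ^ L) : t (b ^ L * k + j) = t k + t j := by
  induction L generalizing j with
  | zero =>
    have : j = 0 := by simpa using hj
    simp [this, ht0]
  | succ L ih =>
    have h1 : j % b < b := Nat.mod_lt _ (by omega)
    have h2 : j / b < b ^ L := Nat.div_lt_of_lt_mul (by rwa [pow_succ'] at hj)
    have e : b ^ (L + 1) * k + j = b * (b ^ L * k + j / b) + j % b := by
      conv_lhs => rw [← Nat.div_add_mod j b]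
      ring
    have e2 : t j = t (j / b) + (j % b : ℕ) := by
      conv_lhs => rw [← Nat.div_add_mod j b]
      exact H _ _ h1
    rw [e, H _ _ h1, ih _ h2, e2, add_assoc]

/-- Appending the digit `1` in base `b` raises the letter by one. -/
theorem exists_lt_pow_eq (H : ∀ k j, j < b → t (b * k + j) = t k + j) (ht0 : t 0 = 0)
    (hb : 2 ≤ b) (s : ℕ) : ∃ c < b ^ s, t c = s := by
  induction s with
  | zero => exact ⟨0, by simp, by simpa using ht0⟩
  | succ s ih =>
    obtain ⟨c, hc, hct⟩ := ih
    refine ⟨b * c + 1, ?_, by rw [H c 1 (by omega), hct]; push_cast; rfl⟩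
    have : b * (c + 1) ≤ b * b ^ s := Nat.mul_le_mul_left b hc
    rw [pow_succ']
    rw [Nat.mul_succ] at this
    omega

theorem sum_windowAvg_letters [NeZero m] {p : ℕ × ℕ} (hp : 0 < p.2) :
    ∑ a : ZMod m, windowAvg {i | t i = a} p = 1 := by
  have hp0 : (p.2 : ℝ) ≠ 0 := by exact_mod_cast hp.ne'
  simp only [windowAvg]
  rw [← Finset.sum_div, Finset.sum_comm, div_eq_one_iff_eq hp0]
  simp [Set.indicator_apply]

/-- Every letter has uniform density `1 / m`. -/
theorem hasDensity_letter [NeZero m] (H : ∀ k j, j < b → t (b * k + j) = t k + j) (ht0 : t 0 = 0)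
    (hb : 2 ≤ b) (a : ZMod m) : HasDensity {i | t i = a} (1 / m) := by
  have hm : m < b ^ m := Nat.lt_pow_self (by omega)
  have hm0 : 0 < m := Nat.pos_of_ne_zero (NeZero.ne m)
  have hex : ∀ a : ZMod m, ∃ c < b ^ m, t c = a := by
    intro a
    obtain ⟨c, hc, hct⟩ := exists_lt_pow_eq H ht0 hb a.val
    exact ⟨c, hc.trans_le (Nat.pow_le_pow_right (by omega) a.val_lt.le), by simpa using hct⟩
  choose σ hσ hσt using hex
  have hBt : ∀ n, ∀ c < b ^ m, t (b ^ m * n + c) = t n + t c := fun n c hc =>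
    block_apply H ht0 hb m n c hc
  generalize b ^ m = B at hm hσ hBt
  have hB0 : (0 : ℝ) < B := by exact_mod_cast (show 0 < B by omega)
  have hmB : (m : ℝ) ≤ B := by exact_mod_cast hm.le
  have hm0' : (0 : ℝ) < m := by exact_mod_cast hm0
  have hinj : Function.Injective σ := fun x y h => by rw [← hσt x, ← hσt y, h]
  -- `J` holds one position per letter in the prefix of length `B = b ^ m`. Over `J` the deviations
  -- from `1 / m` cancel, since the letter averages sum to `1`; only `B - m` of the `B` residues can
  -- carry error.
  set J : Finset ℕ := Finset.univ.image σ with hJ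
  have hJB : J ⊆ Finset.range B := by
    intro c hc
    simp only [hJ, Finset.mem_image, Finset.mem_univ, true_and] at hc
    obtain ⟨a, rfl⟩ := hc
    exact Finset.mem_range.2 (hσ a)
  have hJc : J.card = m := by rw [hJ, Finset.card_image_of_injective _ hinj]; simp [ZMod.card]
  refine hasDensity_of_contraction (A := fun a => {i | t i = a}) (r := fun _ => 1 / (m : ℝ))
    (C := 1 + |1 / (m : ℝ)|) (θ := (B - m) / B) (fun a => nearDensity_trivial _ _)
    (div_nonneg (by linarith) hB0.le) ((div_lt_one hB0).2 (by linarith)) ?_ a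
  intro δ hδ a ε hε
  have hdiv := tendsto_div_longWindows (b := B) (by omega)
  have h1 : ∀ᶠ p : ℕ × ℕ in longWindows, ∀ a : ZMod m,
      |windowAvg {i | t i = a} (p.1 / B, p.2 / B) - 1 / m| ≤ δ + ε / 2 :=
    eventually_all.2 fun a => hdiv.eventually (hδ a (ε / 2) (by positivity))
  have h2 := (Metric.tendsto_nhds.1 (tendsto_windowAvg_sub (b := B) (by omega) {i | t i = a}))
    (ε / 2) (by positivity)
  have h3 : ∀ᶠ p : ℕ × ℕ in longWindows, 0 < p.2 / B :=
    hdiv.eventually (tendsto_snd_longWindows.eventually_gt_atTop 0)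
  filter_upwards [h1, h2, h3] with p hp1 hp2 hp3
  rw [Real.dist_eq, sub_zero] at hp2
  have hs := sum_windowAvg_letters (m := m) (t := t) (p := (p.1 / B, p.2 / B)) hp3
  have hset : ∀ c ∈ Finset.range B, windowAvg {n | t (B * n + c) = a} (p.1 / B, p.2 / B) =
      windowAvg {i | t i = a - t c} (p.1 / B, p.2 / B) := by
    intro c hc
    congr 1
    ext n
    simp only [Set.mem_ofPred_eq]
    rw [hBt n c (Finset.mem_range.1 hc), eq_sub_iff_add_eq]
  rw [Finset.sum_congr rfl hset] at hp2
  generalize windowAvg {i | t i = a} p = y at *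
  set x : ZMod m → ℝ := fun a => windowAvg {i | t i = a} (p.1 / B, p.2 / B) with hx
  have hJs : ∑ c ∈ J, (x (a - t c) - 1 / m) = 0 := by
    rw [hJ, Finset.sum_image fun x _ y _ h => hinj h]
    simp only [hσt]
    have hs' : ∑ a', x (a - a') = 1 := ((Equiv.subLeft a).sum_comp x).trans hs
    rw [Finset.sum_sub_distrib, hs']
    simp [ZMod.card, hm0'.ne']
  have hsum : |∑ c ∈ Finset.range B, (x (a - t c) - 1 / m)| ≤ (B - m) * (δ + ε / 2) := by
    rw [← Finset.sum_sdiff hJB, hJs, add_zero]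
    refine (Finset.abs_sum_le_sum_abs _ _).trans
      ((Finset.sum_le_card_nsmul _ _ _ fun c _ => hp1 (a - t c)).trans ?_)
    rw [Finset.card_sdiff_of_subset hJB, hJc, Finset.card_range, nsmul_eq_mul, Nat.cast_sub hm.le]
  rw [Finset.sum_sub_distrib] at hsum
  simp only [Finset.sum_const, Finset.card_range, nsmul_eq_mul] at hsum
  have e : y - 1 / m = (y - (∑ c ∈ Finset.range B, x (a - t c)) / B) +
      (∑ c ∈ Finset.range B, x (a - t c) - B * (1 / m)) / B := by field_simp; ring
  calc |y - 1 / m| ≤ ε / 2 + ((B - m) * (δ + ε / 2)) / B := by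
        rw [e]
        refine (abs_add_le _ _).trans (add_le_add hp2.le ?_)
        rw [abs_div, abs_of_pos hB0]
        gcongr
    _ = (B - m) / B * δ + (ε / 2 + (B - m) / B * (ε / 2)) := by ring
    _ ≤ (B - m) / B * δ + (ε / 2 + 1 * (ε / 2)) := by
        gcongr
        exact div_le_one_of_le₀ (by linarith) hB0.le
    _ = _ := by ring

/-- The positions at which the letter `a` is read, followed by `a + 1 - k (b - 1)`. -/
def jumpSet (t : ℕ → ZMod m) (b : ℕ) (a : ZMod m) (k : ℕ) : Set ℕ :=
  {i | t i = a ∧ t (i + 1) = a + 1 - k * ((b : ZMod m) - 1)}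

theorem apply_succ_of_not_last (H : ∀ k j, j < b → t (b * k + j) = t k + j) {k c : ℕ}
    (hc : c + 1 < b) : t (b * k + c + 1) = t (b * k + c) + 1 := by
  rw [add_assoc, H k (c + 1) hc, H k c (by omega)]; push_cast; ring

theorem apply_succ_of_last (H : ∀ k j, j < b → t (b * k + j) = t k + j) {k c : ℕ}
    (hc : c + 1 = b) : t (b * k + c + 1) = t (k + 1) := by
  have := H (k + 1) 0 (by omega)
  rw [add_assoc, hc, ← Nat.mul_succ]
  simpa using this

theorem cast_sub_one (hb : 2 ≤ b) {c : ℕ} (hc : c + 1 = b) : (c : ZMod m) = (b : ZMod m) - 1 := by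
  subst hc; push_cast; ring

/-- The step from the last letter of a block is the ancestor's step reduced by `b - 1`. The
hypothesis `hk` asks for `k = k' + 1` only up to multiples of the order of `b - 1`, so that the
passage from `q - 1` to `0` is included. -/
theorem jumpSet_residue_last (H : ∀ k j, j < b → t (b * k + j) = t k + j) (hb : 2 ≤ b)
    (a : ZMod m) (k k' : ℕ) {c : ℕ} (hc : c + 1 = b)
    (hk : ((k : ZMod m) - k' - 1) * ((b : ZMod m) - 1) = 0) :
    {n | b * n + c ∈ jumpSet t b a k} = jumpSet t b (a - ((b : ZMod m) - 1)) k' := by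
  ext n
  simp only [jumpSet, Set.mem_ofPred_eq]
  rw [apply_succ_of_last H hc, H n c (by omega), cast_sub_one hb hc,
    eq_sub_iff_add_eq (a := t n)]
  refine and_congr_right fun _ => ?_
  have : a + 1 - k * ((b : ZMod m) - 1) = a - ((b : ZMod m) - 1) + 1 - k' * ((b : ZMod m) - 1) := by
    linear_combination -hk
  rw [this]

theorem jumpSet_residue (H : ∀ k j, j < b → t (b * k + j) = t k + j)
    (a : ZMod m) (k : ℕ) {c : ℕ} (hc : c + 1 < b) :
    {n | b * n + c ∈ jumpSet t b a k} =
      {n | t n = a - c ∧ (k : ZMod m) * ((b : ZMod m) - 1) = 0} := by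
  ext n
  simp only [jumpSet, Set.mem_ofPred_eq]
  rw [apply_succ_of_not_last H hc, H n c (by omega), eq_sub_iff_add_eq (a := t n)]
  refine and_congr_right fun h => ?_
  rw [h, eq_comm, sub_eq_self]

/-- The density of the factor `01`. -/
noncomputable def baseDensity (b m q : ℕ) : ℝ :=
  (b : ℝ) ^ (q - 1) * ((b : ℝ) - 1) / ((m : ℝ) * ((b : ℝ) ^ q - 1))

theorem baseDensity_eq (hb : 2 ≤ b) (hm : 0 < m) {q : ℕ} (hq : 0 < q) :
    baseDensity b m q = (((b : ℝ) - 1) * (1 / m) + baseDensity b m q / (b : ℝ) ^ (q - 1)) / b := by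
  obtain ⟨q, rfl⟩ := Nat.exists_eq_succ_of_ne_zero hq.ne'
  have hb' : (1 : ℝ) < b := by exact_mod_cast (show 1 < b by omega)
  have h1 : (1 : ℝ) < (b : ℝ) ^ (q + 1) := one_lt_pow₀ hb' (by omega)
  have hm' : (0 : ℝ) < m := by exact_mod_cast hm
  have h2 : (b : ℝ) ^ (q + 1) - 1 ≠ 0 := by linarith
  have h3 : (b : ℝ) ≠ 0 := by linarith
  rw [pow_succ] at h2
  simp only [baseDensity, Nat.succ_eq_add_one, Nat.add_sub_cancel, pow_succ]
  field_simp
  ring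

theorem hasDensity_jumpSet [NeZero m] (H : ∀ k j, j < b → t (b * k + j) = t k + j) (ht0 : t 0 = 0)
    (hb : 2 ≤ b) {q : ℕ} (hq0 : 0 < q) (hqm : (q : ZMod m) * ((b : ZMod m) - 1) = 0)
    (hqmin : ∀ k, 0 < k → k < q → (k : ZMod m) * ((b : ZMod m) - 1) ≠ 0)
    (a : ZMod m) {k : ℕ} (hk : k < q) :
    HasDensity (jumpSet t b a k) (baseDensity b m q / (b : ℝ) ^ k) := by
  have hm0 : 0 < m := Nat.pos_of_ne_zero (NeZero.ne m)
  have hb1 : (1 : ℝ) < b := by exact_mod_cast (show 1 < b by omega)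
  obtain ⟨d, rfl⟩ : ∃ d, b = d + 1 := ⟨b - 1, by omega⟩
  set f := baseDensity (d + 1) m q with hf
  refine hasDensity_of_contraction (ι := ZMod m × Fin q)
    (A := fun x => jumpSet t (d + 1) x.1 x.2) (r := fun x => f / ((d + 1 : ℕ) : ℝ) ^ (x.2 : ℕ))
    (C := 1 + |f|) (θ := 1 / ((d + 1 : ℕ) : ℝ)) ?_ (by positivity)
    ((div_lt_one (by linarith)).2 hb1) ?_ (a, ⟨k, hk⟩)
  · rintro ⟨a, k⟩ ε hε
    filter_upwards [nearDensity_trivial (jumpSet t (d + 1) a k) (f / ((d + 1 : ℕ) : ℝ) ^ (k : ℕ)) ε hε]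
      with p hp
    refine hp.trans ?_
    have : |f / ((d + 1 : ℕ) : ℝ) ^ (k : ℕ)| ≤ |f| := by
      rw [abs_div, abs_of_nonneg (by positivity : (0 : ℝ) ≤ ((d + 1 : ℕ) : ℝ) ^ (k : ℕ))]
      exact div_le_self (abs_nonneg f) (one_le_pow₀ hb1.le)
    linarith
  · rintro δ hδ ⟨a, k, hk⟩
    rcases Nat.eq_zero_or_pos k with rfl | hk0
    · have := NearDensity.split (b := d + 1) (by omega) (A := jumpSet t (d + 1) a 0)
        (r := fun c => if c < d then 1 / (m : ℝ) else f / ((d + 1 : ℕ) : ℝ) ^ (q - 1))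
        (δ := fun c => if c < d then 0 else δ) ?_
      · rw [Finset.sum_range_succ, Finset.sum_range_succ,
          Finset.sum_congr rfl (g := fun _ => 1 / (m : ℝ)) fun c hc => if_pos (Finset.mem_range.1 hc),
          Finset.sum_congr rfl (g := fun _ => (0 : ℝ)) fun c hc => if_pos (Finset.mem_range.1 hc)]
          at this
        have e := baseDensity_eq hb hm0 hq0
        rw [← hf] at e
        simp only [lt_irrefl, if_false, Finset.sum_const, Finset.card_range, nsmul_eq_mul,
          mul_zero, zero_add] at this
        convert this using 1
        · simp only [pow_zero, div_one]
          conv_lhs => rw [e]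
          push_cast; ring
        · ring
      · intro c hc
        rcases Nat.lt_or_ge c d with h | h
        · rw [jumpSet_residue H a 0 (by omega)]
          simp only [h, if_true, Nat.cast_zero, zero_mul, and_true]
          exact hasDensity_iff_nearDensity.1 (hasDensity_letter H ht0 hb _)
        · have hcd : c = d := by omega
          subst hcd
          rw [jumpSet_residue_last H hb a 0 (q - 1) rfl]
          · simpa using hδ (a - ((((c + 1 : ℕ)) : ZMod m) - 1), ⟨q - 1, by omega⟩)
          · rw [Nat.cast_sub (by omega)]; push_cast at hqm ⊢; linear_combination -hqm
    · have := NearDensity.split (b := d + 1) (by omega) (A := jumpSet t (d + 1) a k)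
        (r := fun c => if c < d then 0 else f / ((d + 1 : ℕ) : ℝ) ^ (k - 1))
        (δ := fun c => if c < d then 0 else δ) ?_
      · rw [Finset.sum_range_succ, Finset.sum_range_succ,
          Finset.sum_congr rfl (g := fun _ => (0 : ℝ)) fun c hc => if_pos (Finset.mem_range.1 hc),
          Finset.sum_congr rfl (g := fun _ => (0 : ℝ)) fun c hc => if_pos (Finset.mem_range.1 hc)]
          at this
        simp only [lt_irrefl, if_false, Finset.sum_const_zero, zero_add] at this
        convert this using 1
        · obtain ⟨k, rfl⟩ := Nat.exists_eq_succ_of_ne_zero hk0.ne'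
          simp only [Nat.succ_eq_add_one, Nat.add_sub_cancel, pow_succ]
          rw [div_div]
        · ring
      · intro c hc
        rcases Nat.lt_or_ge c d with h | h
        · rw [jumpSet_residue H a k (by omega)]
          have := hqmin k hk0 hk
          simp only [h, if_true, this, and_false]
          exact hasDensity_iff_nearDensity.1 hasDensity_empty
        · have hcd : c = d := by omega
          subst hcd
          rw [jumpSet_residue_last H hb a k (k - 1) rfl]
          · simpa using hδ (a - ((((c + 1 : ℕ)) : ZMod m) - 1), ⟨k - 1, by omega⟩)
          · rw [Nat.cast_sub (by omega)]; push_cast; ring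

end ThueMorse

/-! ### Occurrences of factors, their ancestors, and runs. -/

section FactorClasses

variable {b m q : ℕ} {t : ℕ → ZMod m}

/-- The word `t` is the fixed point of `φ_{b,m}` starting with `0`, and `q` is the additive order of
`b - 1 ≠ 0` modulo `m`. -/
structure IsThueMorse (b m q : ℕ) (t : ℕ → ZMod m) : Prop where
  two_le : 2 ≤ b
  pos : 0 < m
  cast_ne_one : (b : ZMod m) ≠ 1
  apply_eq : ∀ k j, j < b → t (b * k + j) = t k + j
  zero : t 0 = 0
  q_pos : 0 < q
  q_mul : (q : ZMod m) * ((b : ZMod m) - 1) = 0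
  q_min : ∀ k, 0 < k → k < q → (k : ZMod m) * ((b : ZMod m) - 1) ≠ 0

/-- The positions at which the factor of length `N + 1` at position `x` is read. -/
def factorClass (t : ℕ → ZMod m) (N x : ℕ) : Set ℕ := {i | ∀ j ≤ N, t (i + j) = t (x + j)}

/-- The positions at which the word `a (a + 1) … (a + N)` is read. -/
def runSet (t : ℕ → ZMod m) (a : ZMod m) (N : ℕ) : Set ℕ := {i | ∀ j ≤ N, t (i + j) = a + j}

/-- The densities of the factors of length `N + 1`. -/
def factorDensities (t : ℕ → ZMod m) (N : ℕ) : Set ℝ := {r | ∃ x, HasDensity (factorClass t N x) r}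

namespace IsThueMorse

theorem two_le_q (h : IsThueMorse b m q t) : 2 ≤ q := by
  by_contra hq
  have h1 : q = 1 := by have := h.q_pos; omega
  have := h.q_mul
  rw [h1, Nat.cast_one, one_mul, sub_eq_zero] at this
  exact h.cast_ne_one this

theorem cast_pos (h : IsThueMorse b m q t) : (0 : ℝ) < b := by
  exact_mod_cast (show 0 < b by have := h.two_le; omega)

theorem q_sub_one_mul (h : IsThueMorse b m q t) :
    ((q - 1 : ℕ) : ZMod m) * ((b : ZMod m) - 1) = 1 - b := by
  rw [Nat.cast_sub h.q_pos]
  have := h.q_mul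
  push_cast
  linear_combination this

theorem dvd_of_jump (h : IsThueMorse b m q t) {x : ℕ} (hx : t (x + 1) ≠ t x + 1) : b ∣ x + 1 := by
  have hb := h.two_le
  have hlt := Nat.mod_lt x (show 0 < b by omega)
  have hdm := Nat.div_add_mod x b
  by_contra hd
  apply hx
  have hc : x % b + 1 < b := by
    rcases Nat.lt_or_ge (x % b + 1) b with h1 | h1
    · exact h1
    · refine absurd ⟨x / b + 1, ?_⟩ hd
      rw [Nat.mul_succ]; omega
  have := apply_succ_of_not_last h.apply_eq (k := x / b) hc
  rwa [hdm] at this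

/-- As `b ≠ 1` modulo `m`, both steps are jumps, so `b` would divide the consecutive integers `x +
1` and `x + 2`. -/
theorem not_two_jumps (h : IsThueMorse b m q t) (x : ℕ)
    (h1 : t (x + 1) = t x + b) (h2 : t (x + 1 + 1) = t (x + 1) + b) : False := by
  have hb := h.two_le
  have d1 := h.dvd_of_jump (x := x) (by rw [h1]; simpa using h.cast_ne_one)
  have d2 := h.dvd_of_jump (x := x + 1) (by rw [h2]; simpa using h.cast_ne_one)
  have := (Nat.dvd_add_right d1).1 d2
  have := Nat.le_of_dvd one_pos this
  omega

theorem apply_last (h : IsThueMorse b m q t) (y : ℕ) :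
    t (b * (y + 1) - 1) = t y + b - 1 ∧ t (b * (y + 1)) = t (y + 1) := by
  have hb := h.two_le
  have h1 := h.apply_eq y (b - 1) (by omega)
  rw [cast_sub_one hb (by omega : b - 1 + 1 = b)] at h1
  have h2 := h.apply_eq (y + 1) 0 (by omega)
  refine ⟨?_, by simpa using h2⟩
  rw [show b * (y + 1) - 1 = b * y + (b - 1) by rw [Nat.mul_succ]; omega, h1]; ring

/-- A run of letters `a (a + 1) …` across a multiple of `b` comes from a jump by `b`. -/
theorem jump_of_run (h : IsThueMorse b m q t) {x N y : ℕ}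
    (hrun : ∀ j < N, t (x + j + 1) = t (x + j) + 1) (h1 : x < b * (y + 1))
    (h2 : b * (y + 1) ≤ x + N) : t (y + 1) = t y + b := by
  have := hrun (b * (y + 1) - 1 - x) (by omega)
  obtain ⟨e1, e2⟩ := h.apply_last y
  rw [show x + (b * (y + 1) - 1 - x) = b * (y + 1) - 1 by omega,
    show b * (y + 1) - 1 + 1 = b * (y + 1) by omega, e1, e2] at this
  rw [this]; ring

/-- A jump sits at a block boundary, where the parameter is one more than that of an earlier step;
it returns to `0` when it reaches `q`. -/
theorem exists_jump (h : IsThueMorse b m q t) (x : ℕ) :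
    ∃ k < q, t (x + 1) = t x + 1 - k * ((b : ZMod m) - 1) := by
  have hb := h.two_le
  have hq := h.two_le_q
  induction x using Nat.strong_induction_on with
  | _ x ih =>
    by_cases hx : t (x + 1) = t x + 1
    · exact ⟨0, h.q_pos, by simp [hx]⟩
    · obtain ⟨z, hz⟩ := h.dvd_of_jump hx
      obtain ⟨y, rfl⟩ : ∃ y, z = y + 1 := ⟨z - 1, by
        rcases Nat.eq_zero_or_pos z with rfl | h0
        · simp at hz
        · omega⟩
      obtain ⟨e1, e2⟩ := h.apply_last y
      have hyx : y < x := by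
        have : 2 * (y + 1) ≤ b * (y + 1) := Nat.mul_le_mul_right _ hb
        omega
      obtain ⟨k, hk, e3⟩ := ih y hyx
      rw [← hz, Nat.add_sub_cancel] at e1
      rw [← hz, e3] at e2
      rcases Nat.lt_or_ge (k + 1) q with h1 | h1
      · refine ⟨k + 1, h1, ?_⟩
        rw [e1, e2]; push_cast; ring
      · refine ⟨0, h.q_pos, ?_⟩
        have hkq : k = q - 1 := by omega
        have := h.q_sub_one_mul
        rw [e1, e2, hkq, this]; push_cast; ring

theorem exists_position (h : IsThueMorse b m q t) (k : ℕ) :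
    ∃ x, t (x + 1) = t x + 1 - k * ((b : ZMod m) - 1) := by
  have hb := h.two_le
  induction k with
  | zero =>
    refine ⟨0, ?_⟩
    have := h.apply_eq 0 1 (by omega)
    simpa using this
  | succ k ih =>
    obtain ⟨y, hy⟩ := ih
    obtain ⟨e1, e2⟩ := h.apply_last y
    refine ⟨b * (y + 1) - 1, ?_⟩
    rw [Nat.sub_add_cancel (by nlinarith), e1, e2, hy]
    push_cast; ring

/-- A block is determined by any one of its letters, so the factor at `b * x + c` carries the same
information as the ancestor letters whose blocks it meets, namely `(c + N) / b + 1` of them. -/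
theorem mem_factorClass_residue (h : IsThueMorse b m q t) {N i x c : ℕ} (hc : c < b) :
    b * i + c ∈ factorClass t N (b * x + c) ↔ i ∈ factorClass t ((c + N) / b) x := by
  have hb0 : 0 < b := by omega
  simp only [factorClass, Set.mem_ofPred_eq]
  constructor
  · intro hi u hu
    have hu' : b * u ≤ c + N := (Nat.mul_le_mul_left b hu).trans (Nat.mul_div_le _ _)
    rcases Nat.eq_zero_or_pos u with rfl | hu0
    · have := hi 0 (Nat.zero_le _)
      simpa [h.apply_eq _ _ hc] using this
    · have hbu : b ≤ b * u := Nat.le_mul_of_pos_right b hu0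
      have := hi (b * u - c) (by omega)
      rw [show b * i + c + (b * u - c) = b * (i + u) + 0 by rw [Nat.mul_add]; omega,
        show b * x + c + (b * u - c) = b * (x + u) + 0 by rw [Nat.mul_add]; omega,
        h.apply_eq _ _ hb0, h.apply_eq _ _ hb0] at this
      simpa using this
  · intro hi j hj
    have hdm := Nat.div_add_mod (c + j) b
    have hlt := Nat.mod_lt (c + j) hb0
    rw [show b * i + c + j = b * (i + (c + j) / b) + (c + j) % b by rw [Nat.mul_add]; omega,
      show b * x + c + j = b * (x + (c + j) / b) + (c + j) % b by rw [Nat.mul_add]; omega,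
      h.apply_eq _ _ hlt, h.apply_eq _ _ hlt, hi _ (Nat.div_le_div_right (by omega))]

theorem setOf_factorClass (h : IsThueMorse b m q t) {N x c : ℕ} (hc : c < b) :
    {n | b * n + c ∈ factorClass t N (b * x + c)} = factorClass t ((c + N) / b) x :=
  Set.ext fun _ => h.mem_factorClass_residue hc

theorem mem_runSet_residue (h : IsThueMorse b m q t) {a : ZMod m} {N i c : ℕ} (hc : c < b) :
    b * i + c ∈ runSet t a N ↔ ∀ u ≤ (c + N) / b, t (i + u) = a - c + b * u := by
  have hb0 : 0 < b := by omega
  simp only [runSet, Set.mem_ofPred_eq]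
  constructor
  · intro hi u hu
    have hu' : b * u ≤ c + N := (Nat.mul_le_mul_left b hu).trans (Nat.mul_div_le _ _)
    rcases Nat.eq_zero_or_pos u with rfl | hu0
    · have := hi 0 (Nat.zero_le _)
      rw [add_zero, h.apply_eq _ _ hc] at this
      rw [add_zero, eq_sub_of_add_eq this]; simp
    · have hbu : b ≤ b * u := Nat.le_mul_of_pos_right b hu0
      have := hi (b * u - c) (by omega)
      rw [show b * i + c + (b * u - c) = b * (i + u) + 0 by rw [Nat.mul_add]; omega,
        h.apply_eq _ _ hb0, Nat.cast_sub (by omega)] at this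
      push_cast at this
      linear_combination this
  · intro hi j hj
    have hdm := Nat.div_add_mod (c + j) b
    have hlt := Nat.mod_lt (c + j) hb0
    have hcast := congrArg (Nat.cast : ℕ → ZMod m) hdm
    push_cast at hcast
    rw [show b * i + c + j = b * (i + (c + j) / b) + (c + j) % b by rw [Nat.mul_add]; omega,
      h.apply_eq _ _ hlt, hi _ (Nat.div_le_div_right (by omega))]
    linear_combination hcast

theorem factorClass_eq_runSet {N x : ℕ} (hx : ∀ j < N, t (x + j + 1) = t (x + j) + 1) :
    factorClass t N x = runSet t (t x) N := by
  have : ∀ j ≤ N, t (x + j) = t x + j := by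
    intro j hj
    induction j with
    | zero => simp
    | succ j ih => rw [← add_assoc, hx j hj, ih (by omega)]; push_cast; ring
  ext i
  simp only [factorClass, runSet, Set.mem_ofPred_eq]
  exact forall₂_congr fun j hj => by rw [this j hj]

theorem factorClass_zero (x : ℕ) : factorClass t 0 x = {i | t i = t x} := by
  ext i; simp [factorClass]

theorem factorClass_one {x k : ℕ} (hx : t (x + 1) = t x + 1 - k * ((b : ZMod m) - 1)) :
    factorClass t 1 x = jumpSet t b (t x) k := by
  ext i
  simp only [factorClass, jumpSet, Set.mem_ofPred_eq]
  constructor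
  · intro hi
    have h0 := hi 0 (by omega)
    have h1 := hi 1 le_rfl
    rw [hx] at h1
    exact ⟨by simpa using h0, h1⟩
  · rintro ⟨h0, h1⟩ j hj
    interval_cases j
    · simpa using h0
    · rw [h1, hx]

theorem factorClass_eq_of_mem {N x y : ℕ} (hy : y ∈ factorClass t N x) :
    factorClass t N x = factorClass t N y := by
  ext i
  exact forall₂_congr fun j hj => by rw [hy j hj]

theorem hasDensity_letter (h : IsThueMorse b m q t) (a : ZMod m) :
    HasDensity {i | t i = a} (1 / m) :=
  haveI : NeZero m := ⟨h.pos.ne'⟩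
  _root_.hasDensity_letter h.apply_eq h.zero h.two_le a

theorem hasDensity_jumpSet (h : IsThueMorse b m q t) (a : ZMod m) {k : ℕ} (hk : k < q) :
    HasDensity (jumpSet t b a k) (baseDensity b m q / (b : ℝ) ^ k) :=
  haveI : NeZero m := ⟨h.pos.ne'⟩
  _root_.hasDensity_jumpSet h.apply_eq h.zero h.two_le h.q_pos h.q_mul h.q_min a hk

theorem exists_hasDensity (h : IsThueMorse b m q t) (N x : ℕ) :
    ∃ r, HasDensity (factorClass t N x) r := by
  have hb := h.two_le
  induction N using Nat.strong_induction_on generalizing x with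
  | _ N ih =>
    rcases Nat.lt_or_ge N 2 with hN | hN
    · interval_cases N
      · exact ⟨_, factorClass_zero x ▸ h.hasDensity_letter _⟩
      · obtain ⟨k, hk, hx⟩ := h.exists_jump x
        exact ⟨_, factorClass_one hx ▸ h.hasDensity_jumpSet _ hk⟩
    · have : ∀ c, ∃ r, c < b → HasDensity {n | b * n + c ∈ factorClass t N x} r := by
        intro c
        by_cases hc : c < b
        · by_cases hy : ∃ y, b * y + c ∈ factorClass t N x
          · obtain ⟨y, hy⟩ := hy
            -- The descent is strict only for `N ≥ 2`, which is why letters and pairs need the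
            -- contraction argument.
            have hlt : (c + N) / b < N := by
              rw [Nat.div_lt_iff_lt_mul (by omega)]
              nlinarith
            obtain ⟨r, hr⟩ := ih _ hlt y
            refine ⟨r, fun _ => ?_⟩
            rw [factorClass_eq_of_mem hy]
            rw [h.setOf_factorClass hc]
            exact hr
          · push Not at hy
            refine ⟨0, fun _ => ?_⟩
            simpa [hy] using hasDensity_empty
        · exact ⟨0, fun h' => absurd h' hc⟩
      choose r hr using this
      exact ⟨_, HasDensity.split (by omega) hr⟩

/-- A factor containing a jump determines its position modulo `b`. -/
theorem hasDensity_of_jump (h : IsThueMorse b m q t) {N x c j : ℕ} {r : ℝ} (hc : c < b) (hj : j < N)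
    (hjump : t (b * x + c + j + 1) ≠ t (b * x + c + j) + 1)
    (hr : HasDensity (factorClass t ((c + N) / b) x) r) :
    HasDensity (factorClass t N (b * x + c)) (r / b) := by
  refine HasDensity.of_residue hc (fun i hi => ?_) ?_
  · have h1 := hi j hj.le
    have h2 := hi (j + 1) hj
    rw [← add_assoc, ← add_assoc] at h2
    have d1 := h.dvd_of_jump (x := i + j) (by rwa [h1, h2])
    have d2 := h.dvd_of_jump hjump
    have e : i ≡ b * x + c [MOD b] := by
      have : i + (j + 1) ≡ b * x + c + (j + 1) [MOD b] := by
        unfold Nat.ModEq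
        rw [← add_assoc, ← add_assoc, Nat.mod_eq_zero_of_dvd d1, Nat.mod_eq_zero_of_dvd d2]
      exact Nat.ModEq.add_right_cancel' _ this
    rw [e, Nat.mul_add_mod, Nat.mod_eq_of_lt hc]
  · rw [h.setOf_factorClass hc]
    exact hr

theorem mem_factorDensities_of_hasDensity (h : IsThueMorse b m q t) {N N' x c j : ℕ} {r : ℝ}
    (hc : c < b) (hj : j < N) (hN' : (c + N) / b = N')
    (hjump : t (b * x + c + j + 1) ≠ t (b * x + c + j) + 1)
    (hr : HasDensity (factorClass t N' x) r) : r / b ∈ factorDensities t N :=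
  ⟨_, h.hasDensity_of_jump hc hj hjump (hN' ▸ hr)⟩

/-- This and the next two lemmas sort the residues `c` by the number of block boundaries that a run
starting there crosses: none, one, or at least two. -/
theorem setOf_runSet_of_lt (h : IsThueMorse b m q t) {a : ZMod m} {N c : ℕ}
    (hc : c + N < b) : {n | b * n + c ∈ runSet t a N} = {n | t n = a - c} := by
  ext n
  rw [Set.mem_ofPred_eq, h.mem_runSet_residue (by omega), Nat.div_eq_of_lt hc]
  simp

theorem setOf_runSet_of_le (h : IsThueMorse b m q t) {a : ZMod m} {N c : ℕ} (hcb : c < b)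
    (hc : b ≤ c + N) (hc' : c + N < 2 * b) :
    {n | b * n + c ∈ runSet t a N} = jumpSet t b (a - c) (q - 1) := by
  ext n
  have hd : (c + N) / b = 1 := Nat.div_eq_of_lt_le (by omega) (by omega)
  rw [Set.mem_ofPred_eq, h.mem_runSet_residue hcb, hd, jumpSet, Set.mem_ofPred_eq, h.q_sub_one_mul]
  constructor
  · intro hn
    have h0 := hn 0 (by omega)
    have h1 := hn 1 le_rfl
    push_cast at h0 h1
    exact ⟨by simpa using h0, by rw [h1]; ring⟩
  · rintro ⟨h0, h1⟩ u hu
    interval_cases u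
    · simpa using h0
    · rw [h1]; push_cast; ring

theorem setOf_runSet_of_ge (h : IsThueMorse b m q t) {a : ZMod m} {N c : ℕ} (hcb : c < b)
    (hc : 2 * b ≤ c + N) : {n | b * n + c ∈ runSet t a N} = ∅ := by
  ext n
  rw [Set.mem_ofPred_eq, h.mem_runSet_residue hcb]
  simp only [Set.mem_empty_iff_false, iff_false]
  intro hn
  have hd : 2 ≤ (c + N) / b := (Nat.le_div_iff_mul_le (by omega)).2 hc
  have h0 := hn 0 (by omega)
  have h1 := hn 1 (by omega)
  have h2 := hn 2 hd
  push_cast at h0 h1 h2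
  refine h.not_two_jumps n ?_ ?_
  · rw [h1]; rw [add_zero] at h0; rw [h0]; ring
  · rw [add_assoc, h1]; norm_num; rw [h2]; ring

/-- Of the `b` starting residues, `b - N` keep the run inside a block (density `1 / m`) and `N` make
it cross one boundary (density `f / b ^ (q - 1)`); `baseDensity_eq` eliminates the latter. -/
theorem hasDensity_runSet_of_le (h : IsThueMorse b m q t) (a : ZMod m) {N : ℕ} (hN : N ≤ b) :
    HasDensity (runSet t a N) (N * baseDensity b m q - (N - 1) / m) := by
  have hb := h.two_le
  have hb0 := h.cast_pos
  have hm0 : (0 : ℝ) < m := by exact_mod_cast h.pos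
  have e := baseDensity_eq (b := b) (m := m) h.two_le h.pos h.q_pos
  have := HasDensity.split (b := b) (by omega) (A := runSet t a N)
    (r := fun c => if c < b - N then 1 / (m : ℝ) else baseDensity b m q / (b : ℝ) ^ (q - 1)) ?_
  · generalize baseDensity b m q = f at *
    generalize f / (b : ℝ) ^ (q - 1) = g at *
    have hs : ∑ c ∈ Finset.range b, (if c < b - N then 1 / (m : ℝ) else g) =
        (b - N) * (1 / m) + N * g := by
      obtain ⟨d, rfl⟩ := Nat.exists_eq_add_of_le hN
      rw [add_comm N d, Finset.sum_range_add, Nat.add_sub_cancel,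
        Finset.sum_congr rfl (g := fun _ => 1 / (m : ℝ)) fun c hc => if_pos (Finset.mem_range.1 hc),
        Finset.sum_congr rfl (s₁ := Finset.range N) (g := fun _ => g) fun c hc => if_neg (by omega)]
      simp
    rw [hs] at this
    convert this using 1
    field_simp at e ⊢
    linear_combination (N : ℝ) * e
  · intro c hc
    by_cases h1 : c < b - N
    · rw [h.setOf_runSet_of_lt (by omega)]
      simpa only [h1, if_true] using h.hasDensity_letter _
    · rw [h.setOf_runSet_of_le hc (by omega) (by omega)]
      simpa only [h1, if_false] using h.hasDensity_jumpSet _ (by have := h.q_pos; omega)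

/-- Here `2 * b - N` residues make the run cross exactly one boundary, and the others two, which is
impossible. -/
theorem hasDensity_runSet_of_ge (h : IsThueMorse b m q t) (a : ZMod m) {N : ℕ} (hN : b ≤ N)
    (hN' : N ≤ 2 * b) : HasDensity (runSet t a N)
      (1 / (b : ℝ) ^ (q - 1) * baseDensity b m q - (N - b) / (b : ℝ) ^ q * baseDensity b m q) := by
  have hb := h.two_le
  have hb0 := h.cast_pos
  have := HasDensity.split (b := b) (by omega) (A := runSet t a N)
    (r := fun c => if c < 2 * b - N then baseDensity b m q / (b : ℝ) ^ (q - 1) else 0) ?_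
  · have hs : ∀ g : ℝ, ∑ c ∈ Finset.range b, (if c < 2 * b - N then g else 0) =
        (2 * b - N) * g := by
      intro g
      rw [← Finset.sum_filter, Finset.sum_const, nsmul_eq_mul]
      congr 1
      rw [show (Finset.range b).filter (fun c => c < 2 * b - N) = Finset.range (2 * b - N) by
        ext c; simp; omega, Finset.card_range, Nat.cast_sub hN']
      push_cast; rfl
    rw [hs] at this
    convert this using 1
    obtain ⟨q', rfl⟩ := Nat.exists_eq_succ_of_ne_zero h.q_pos.ne'
    simp only [Nat.succ_eq_add_one, Nat.add_sub_cancel, pow_succ]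
    field_simp
    ring
  · intro c hc
    by_cases h1 : c < 2 * b - N
    · rw [h.setOf_runSet_of_le hc (by omega) (by omega)]
      simpa only [h1, if_true] using h.hasDensity_jumpSet _ (by have := h.q_pos; omega)
    · rw [h.setOf_runSet_of_ge hc (by omega)]
      simpa only [h1, if_false] using hasDensity_empty

end IsThueMorse

end FactorClasses

/-! ### The table of densities: short factors, then scaling. -/

namespace IsThueMorse

variable {b m q : ℕ} {t : ℕ → ZMod m}

theorem exists_jump_by_b (h : IsThueMorse b m q t) : ∃ x, t (x + 1) = t x + b := by
  obtain ⟨x, hx⟩ := h.exists_position (q - 1)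
  exact ⟨x, by rw [hx, h.q_sub_one_mul]; ring⟩

/-- The images of two letters `a` and `a + b` join into a run of `2 * b` letters. -/
theorem exists_run (h : IsThueMorse b m q t) {N : ℕ} (hN : N < 2 * b) :
    ∃ x, factorClass t N x = runSet t (t x) N := by
  obtain ⟨y, hy⟩ := h.exists_jump_by_b
  have hb := h.two_le
  refine ⟨b * y + 0, factorClass_eq_runSet fun j hj => ?_⟩
  have : b * y + 0 ∈ runSet t (t (b * y + 0)) N := by
    rw [h.mem_runSet_residue (by omega), h.apply_eq _ _ (by omega)]
    intro u hu
    have : (0 + N) / b < 2 := by rw [Nat.div_lt_iff_lt_mul (by omega)]; omega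
    have : u < 2 := by omega
    interval_cases u
    · simp
    · rw [hy]; simp
  rw [this j (by omega), add_assoc, this (j + 1) hj]
  push_cast; ring

theorem jump_of_exists_position (h : IsThueMorse b m q t) {k : ℕ} (hk : 0 < k) (hkq : k < q) :
    ∃ x, HasDensity (factorClass t 1 x) (baseDensity b m q / (b : ℝ) ^ (k - 1)) ∧
      t (x + 1) ≠ t x + b := by
  obtain ⟨x, hx⟩ := h.exists_position (k - 1)
  refine ⟨x, factorClass_one hx ▸ h.hasDensity_jumpSet _ (by omega), fun h' => ?_⟩
  rw [hx, Nat.cast_sub (by omega)] at h'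
  refine h.q_min k hk hkq ?_
  push_cast at h'
  linear_combination -h'

/-- The block `[b x + b - 1, b x + b]` contains a jump unless `x` is followed by a jump by `b`. -/
theorem jump_last (h : IsThueMorse b m q t) {x : ℕ} (hx : t (x + 1) ≠ t x + b) :
    t (b * x + (b - 1) + 0 + 1) ≠ t (b * x + (b - 1) + 0) + 1 := by
  obtain ⟨e1, e2⟩ := h.apply_last x
  have hb := h.two_le
  rw [show b * x + (b - 1) + 0 + 1 = b * (x + 1) by rw [Nat.mul_succ]; omega,
    show b * x + (b - 1) + 0 = b * (x + 1) - 1 by rw [Nat.mul_succ]; omega, e1, e2]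
  intro h'
  apply hx
  rw [h']; ring

theorem exists_div_pow_of_one (h : IsThueMorse b m q t) {x : ℕ} {r : ℝ}
    (hr : HasDensity (factorClass t 1 x) r) :
    ∃ k < q, t (x + 1) = t x + 1 - k * ((b : ZMod m) - 1) ∧
      r = baseDensity b m q / (b : ℝ) ^ k := by
  obtain ⟨k, hk, hx⟩ := h.exists_jump x
  have := h.hasDensity_jumpSet (t x) hk
  rw [← factorClass_one hx] at this
  exact ⟨k, hk, hx, hr.unique this⟩

theorem mem_factorDensities_of_le (h : IsThueMorse b m q t) {N : ℕ} (hN1 : 1 ≤ N) (hN : N ≤ b)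
    {r : ℝ} : r ∈ factorDensities t N ↔ r = N * baseDensity b m q - (N - 1) / m ∨
      ∃ k ∈ Finset.Icc 1 (q - 1), r = baseDensity b m q / (b : ℝ) ^ k := by
  have hb := h.two_le
  have hb0 := h.cast_pos
  constructor
  · rintro ⟨X, hX⟩
    by_cases hrun : ∀ j < N, t (X + j + 1) = t (X + j) + 1
    · left
      rw [factorClass_eq_runSet hrun] at hX
      exact hX.unique (h.hasDensity_runSet_of_le _ hN)
    · right
      push Not at hrun
      obtain ⟨j, hj, hjump⟩ := hrun
      obtain ⟨z, hz⟩ := h.dvd_of_jump hjump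
      have hlt := Nat.mod_lt X (show 0 < b by omega)
      have hdm := Nat.div_add_mod X b
      obtain ⟨x, c, hc, rfl⟩ : ∃ x c, c < b ∧ X = b * x + c := ⟨_, _, hlt, hdm.symm⟩
      clear hlt hdm
      have hzx : z = x + 1 := by
        have h1 : x < z := by
          have : b * x < b * z := by omega
          exact Nat.lt_of_mul_lt_mul_left this
        have h2 : z < x + 2 := by
          have : b * z < b * (x + 2) := by rw [Nat.mul_add]; omega
          exact Nat.lt_of_mul_lt_mul_left this
        omega
      subst hzx
      obtain ⟨r', hr'⟩ := h.exists_hasDensity ((c + N) / b) x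
      have hu := hX.unique (h.hasDensity_of_jump hc hj hjump hr')
      have hd : (c + N) / b = 1 :=
        Nat.div_eq_of_lt_le (by rw [Nat.mul_succ] at hz; omega) (by omega)
      rw [hd] at hr'
      obtain ⟨k, hk, hx, rfl⟩ := h.exists_div_pow_of_one hr'
      refine ⟨k + 1, Finset.mem_Icc.2 ⟨by omega, ?_⟩, by rw [hu, pow_succ, div_div]⟩
      -- The parameter `q - 1` is excluded: it would make the boundary step `+1`, whereas the only
      -- boundary within reach carries the jump.
      by_contra hkq
      have hkq' : k = q - 1 := by omega
      obtain ⟨e1, e2⟩ := h.apply_last x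
      rw [hz, show b * x + c + j = b * (x + 1) - 1 by omega, e1, e2, hx, hkq',
        h.q_sub_one_mul] at hjump
      apply hjump; ring
  · rintro (rfl | ⟨k, hk, rfl⟩)
    · obtain ⟨x, hx⟩ := h.exists_run (N := N) (by omega)
      exact ⟨x, hx ▸ h.hasDensity_runSet_of_le _ hN⟩
    · rw [Finset.mem_Icc] at hk
      obtain ⟨x, hr, hx⟩ := h.jump_of_exists_position (k := k) (by omega) (by omega)
      have := h.mem_factorDensities_of_hasDensity (c := b - 1) (j := 0) (N := N) (by omega)
        (by omega) (Nat.div_eq_of_lt_le (by omega) (by omega)) (h.jump_last hx) hr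
      obtain ⟨k', rfl⟩ := Nat.exists_eq_succ_of_ne_zero (show k ≠ 0 by omega)
      rwa [div_div, ← pow_succ] at this

theorem mem_factorDensities_of_ge (h : IsThueMorse b m q t) {N : ℕ} (hN : b + 1 ≤ N)
    (hN' : N ≤ 2 * b - 1) {r : ℝ} : r ∈ factorDensities t N ↔
      r = 1 / (b : ℝ) ^ (q - 1) * baseDensity b m q - (N - b) / (b : ℝ) ^ q * baseDensity b m q ∨
      r = (2 * baseDensity b m q - 1 / m) / b ∨
      ∃ k ∈ Finset.Icc 1 q, r = baseDensity b m q / (b : ℝ) ^ k := by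
  have hb := h.two_le
  have hq := h.two_le_q
  have hb0 := h.cast_pos
  have htwo : ∀ s, s ∈ factorDensities t 2 ↔ s = 2 * baseDensity b m q - 1 / m ∨
      ∃ k ∈ Finset.Icc 1 (q - 1), s = baseDensity b m q / (b : ℝ) ^ k := by
    intro s
    rw [h.mem_factorDensities_of_le (by norm_num) hb]
    norm_num
  -- Starting at the last letter of a block, a factor with `N ≥ b + 1` crosses two boundaries, so it
  -- has a jump and its ancestor has three letters.
  have htwo' : ∀ s, s ∈ factorDensities t 2 → s / b ∈ factorDensities t N := by
    rintro s ⟨x, hx⟩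
    by_cases hrun : ∀ j < N, t (b * x + (b - 1) + j + 1) = t (b * x + (b - 1) + j) + 1
    · refine (h.not_two_jumps x ?_ ?_).elim
      · exact h.jump_of_run hrun (by rw [Nat.mul_succ]; omega) (by rw [Nat.mul_succ]; omega)
      · refine h.jump_of_run hrun ?_ ?_ <;> rw [Nat.mul_add, Nat.mul_add] <;> omega
    · push Not at hrun
      obtain ⟨j, hj, hjump⟩ := hrun
      exact h.mem_factorDensities_of_hasDensity (by omega) hj
        (Nat.div_eq_of_lt_le (by omega) (by omega)) hjump hx
  constructor
  · rintro ⟨X, hX⟩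
    by_cases hrun : ∀ j < N, t (X + j + 1) = t (X + j) + 1
    · left
      rw [factorClass_eq_runSet hrun] at hX
      exact hX.unique (h.hasDensity_runSet_of_ge _ (by omega) (by omega))
    · right
      push Not at hrun
      obtain ⟨j, hj, hjump⟩ := hrun
      have hlt := Nat.mod_lt X (show 0 < b by omega)
      have hdm := Nat.div_add_mod X b
      obtain ⟨x, c, hc, rfl⟩ : ∃ x c, c < b ∧ X = b * x + c := ⟨_, _, hlt, hdm.symm⟩
      obtain ⟨r', hr'⟩ := h.exists_hasDensity ((c + N) / b) x
      have hu := hX.unique (h.hasDensity_of_jump hc hj hjump hr')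
      rcases Nat.lt_or_ge (c + N) (2 * b) with hcN | hcN
      · rw [show (c + N) / b = 1 from Nat.div_eq_of_lt_le (by omega) (by omega)] at hr'
        obtain ⟨k, hk, -, rfl⟩ := h.exists_div_pow_of_one hr'
        exact Or.inr ⟨k + 1, Finset.mem_Icc.2 ⟨by omega, by omega⟩, by rw [hu, pow_succ, div_div]⟩
      · rw [show (c + N) / b = 2 from Nat.div_eq_of_lt_le (by omega) (by omega)] at hr'
        rcases (htwo r').1 ⟨x, hr'⟩ with rfl | ⟨k, hk, rfl⟩
        · exact Or.inl hu
        · rw [Finset.mem_Icc] at hk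
          exact Or.inr ⟨k + 1, Finset.mem_Icc.2 ⟨by omega, by omega⟩,
            by rw [hu, pow_succ, div_div]⟩
  · rintro (rfl | rfl | ⟨k, hk, rfl⟩)
    · obtain ⟨x, hx⟩ := h.exists_run (N := N) (by omega)
      exact ⟨x, hx ▸ h.hasDensity_runSet_of_ge _ (by omega) (by omega)⟩
    · exact htwo' _ ((htwo _).2 (Or.inl rfl))
    · rw [Finset.mem_Icc] at hk
      obtain ⟨k', rfl⟩ := Nat.exists_eq_succ_of_ne_zero (show k ≠ 0 by omega)
      rw [Nat.succ_eq_add_one, pow_succ, ← div_div]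
      -- The value `f / b` is not supplied by three-letter ancestors through `htwo`. It comes from a
      -- pair of density `f`, with the factor starting at residue `0` and the jump at the end of the
      -- first block.
      rcases Nat.eq_zero_or_pos k' with rfl | hk'
      · obtain ⟨x, hr, hx⟩ := h.jump_of_exists_position (k := 1) one_pos (by omega)
        refine h.mem_factorDensities_of_hasDensity (c := 0) (j := b - 1) (N := N) (x := x) (by omega)
          (by omega) (Nat.div_eq_of_lt_le (by omega) (by omega)) ?_ hr
        simpa using h.jump_last hx
      · exact htwo' _ ((htwo _).2 (Or.inr ⟨k', Finset.mem_Icc.2 ⟨hk', by omega⟩, rfl⟩))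

/-- A factor with `N ≥ 2 * b` crosses two boundaries from any residue, hence has a jump. As `c`
varies, `(c + N) / b` takes only its values at `c = 0` and `c = b - 1`. -/
theorem mem_factorDensities_div (h : IsThueMorse b m q t) {N : ℕ} (hN : 2 * b ≤ N) {r : ℝ} :
    r ∈ factorDensities t N ↔
      b * r ∈ factorDensities t (N / b) ∨ b * r ∈ factorDensities t ((b - 1 + N) / b) := by
  have hb := h.two_le
  have hb0 := h.cast_pos
  have key : ∀ x c : ℕ, c < b → ∀ s, HasDensity (factorClass t ((c + N) / b) x) s →
      HasDensity (factorClass t N (b * x + c)) (s / b) := by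
    intro x c hc s hs
    by_cases hrun : ∀ j < N, t (b * x + c + j + 1) = t (b * x + c + j) + 1
    · refine (h.not_two_jumps x ?_ ?_).elim <;> refine h.jump_of_run hrun ?_ ?_ <;>
        simp only [Nat.mul_add, Nat.mul_one] <;> omega
    · push Not at hrun
      obtain ⟨j, hj, hjump⟩ := hrun
      exact h.hasDensity_of_jump hc hj hjump hs
  constructor
  · rintro ⟨X, hX⟩
    have hlt := Nat.mod_lt X (show 0 < b by omega)
    have hdm := Nat.div_add_mod X b
    obtain ⟨x, c, hc, rfl⟩ : ∃ x c, c < b ∧ X = b * x + c := ⟨_, _, hlt, hdm.symm⟩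
    obtain ⟨r', hr'⟩ := h.exists_hasDensity ((c + N) / b) x
    have hu := hX.unique (key x c hc r' hr')
    have e : (b : ℝ) * r = r' := by rw [hu]; field_simp
    rw [e]
    have h1 : N / b ≤ (c + N) / b := Nat.div_le_div_right (by omega)
    have h2 : (c + N) / b ≤ (b - 1 + N) / b := Nat.div_le_div_right (by omega)
    have h3 : (b - 1 + N) / b ≤ N / b + 1 := by
      rw [← Nat.add_div_right N (by omega)]; exact Nat.div_le_div_right (by omega)
    rcases Nat.lt_or_ge (N / b) ((c + N) / b) with h4 | h4
    · right
      rw [show (b - 1 + N) / b = (c + N) / b by omega]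
      exact ⟨x, hr'⟩
    · left
      rw [show N / b = (c + N) / b by omega]
      exact ⟨x, hr'⟩
  · rintro (⟨x, hx⟩ | ⟨x, hx⟩)
    · have := key x 0 (by omega) _ (by rwa [Nat.zero_add])
      exact ⟨_, by simpa [hb0.ne'] using this⟩
    · have := key x (b - 1) (by omega) _ hx
      exact ⟨_, by simpa [hb0.ne'] using this⟩

theorem mem_factorDensities_mul_pow (h : IsThueMorse b m q t) {n : ℕ} (hn : 2 ≤ n) (l : ℕ)
    {r : ℝ} : r ∈ factorDensities t (n * b ^ l) ↔ (b : ℝ) ^ l * r ∈ factorDensities t n := by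
  have hb := h.two_le
  induction l generalizing r with
  | zero => simp
  | succ l ih =>
    have ih' : ∀ s : ℝ, s ∈ factorDensities t (n * b ^ l) ↔ (b : ℝ) ^ l * s ∈ factorDensities t n :=
      fun s => ih
    have e : n * b ^ (l + 1) = b * (n * b ^ l) := by ring
    have hpos : 1 ≤ b ^ l := Nat.one_le_pow _ _ (by omega)
    have h2 : 2 * b ≤ b * (n * b ^ l) := by
      rw [mul_comm 2 b]; exact Nat.mul_le_mul_left b (by nlinarith)
    rw [e, h.mem_factorDensities_div h2, Nat.mul_div_cancel_left _ (by omega),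
      Nat.add_mul_div_left _ _ (by omega), Nat.div_eq_of_lt (by omega), zero_add, or_self, ih',
      pow_succ, mul_assoc]

/-- Dividing by `b` and rounding down may reach the left endpoint one level below, rounding up the
right one; strictly between them the induction hypothesis applies. At level `0` the open interval is
empty. -/
theorem mem_factorDensities_between (h : IsThueMorse b m q t) {n : ℕ} (hn : 3 ≤ n) (l : ℕ) {N : ℕ}
    (h1 : (n - 1) * b ^ l < N) (h2 : N < n * b ^ l) {r : ℝ} : r ∈ factorDensities t N ↔
      (b : ℝ) ^ l * r ∈ factorDensities t (n - 1) ∨ (b : ℝ) ^ l * r ∈ factorDensities t n := by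
  have hb := h.two_le
  induction l generalizing r N with
  | zero => simp at h1 h2; omega
  | succ l ih =>
    have hpos : 1 ≤ b ^ l := Nat.one_le_pow _ _ (by omega)
    have e1 : (n - 1) * b ^ (l + 1) = b * ((n - 1) * b ^ l) := by ring
    have e2 : n * b ^ (l + 1) = b * (n * b ^ l) := by ring
    rw [e1] at h1
    rw [e2] at h2
    have h3 : 2 * b ≤ N := by
      refine le_trans ?_ h1.le
      rw [mul_comm 2 b]
      refine Nat.mul_le_mul_left b (le_trans ?_ (Nat.mul_le_mul_left _ hpos))
      omega
    rw [h.mem_factorDensities_div h3]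
    have a1 : (n - 1) * b ^ l ≤ N / b := by
      rw [Nat.le_div_iff_mul_le (by omega), mul_comm]; exact h1.le
    have a2 : N / b < n * b ^ l := by
      rw [Nat.div_lt_iff_lt_mul (by omega), mul_comm]; exact h2
    have a3 : (n - 1) * b ^ l < (b - 1 + N) / b := by
      rw [Nat.lt_iff_add_one_le, Nat.le_div_iff_mul_le (by omega), mul_comm, Nat.mul_succ]; omega
    have a4 : (b - 1 + N) / b ≤ n * b ^ l := by
      rw [← Nat.lt_succ_iff, Nat.div_lt_iff_lt_mul (by omega), mul_comm, Nat.mul_succ]; omega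
    have ep : (b : ℝ) ^ (l + 1) * r = (b : ℝ) ^ l * (b * r) := by rw [pow_succ, mul_assoc]
    rw [ep]
    generalize (b : ℝ) * r = s
    have ih' : ∀ M, (n - 1) * b ^ l < M → M < n * b ^ l → (s ∈ factorDensities t M ↔
      (b : ℝ) ^ l * s ∈ factorDensities t (n - 1) ∨ (b : ℝ) ^ l * s ∈ factorDensities t n) :=
      fun M h1 h2 => ih h1 h2
    have hl := h.mem_factorDensities_mul_pow (n := n - 1) (by omega) l (r := s)
    have hr := h.mem_factorDensities_mul_pow (n := n) (by omega) l (r := s)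
    rcases a1.eq_or_lt with c1 | c1 <;> rcases a4.eq_or_lt with c2 | c2
    · rw [← c1, c2, hl, hr]
    · rw [← c1, hl, ih' _ a3 c2]; tauto
    · rw [c2, hr, ih' _ c1 a2]; tauto
    · rw [ih' _ c1 a2, ih' _ a3 c2, or_self]

end IsThueMorse

/-! ### From densities of positions to frequencies of words. -/

section Frequencies

theorem length_wordFactor {α : Type*} (u : ℕ → α) (i n : ℕ) : (wordFactor u i n).length = n := by
  simp [wordFactor]

theorem wordFactor_eq_iff {α : Type*} {u : ℕ → α} {i x n : ℕ} :
    wordFactor u i n = wordFactor u x n ↔ ∀ j < n, u (i + j) = u (x + j) := by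
  simp [wordFactor, List.map_inj_left]

theorem drop_wordFactor {α : Type*} (u : ℕ → α) (i k n : ℕ) :
    (wordFactor u i n).drop k = wordFactor u (i + k) (n - k) := by
  apply List.ext_getElem <;> simp [wordFactor, add_assoc]

theorem prefix_wordFactor_iff {α : Type*} (u : ℕ → α) (i n : ℕ) (w : List α) :
    w <+: wordFactor u i n ↔ w.length ≤ n ∧ wordFactor u i w.length = w := by
  rw [List.prefix_iff_eq_take]
  constructor
  · intro h
    have hl := congrArg List.length h
    rw [List.length_take, length_wordFactor] at hl
    have hle : w.length ≤ n := by omega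
    refine ⟨hle, ?_⟩
    conv_rhs => rw [h]
    simp [wordFactor, ← List.map_take, List.take_range, hle]
  · rintro ⟨hle, h⟩
    conv_lhs => rw [← h]
    simp [wordFactor, ← List.map_take, List.take_range, hle]

/-- Limits over long factors are limits over long windows; a factor read at several positions does
no harm, as the windows' positions are unrestricted. -/
theorem map_wordFactor_longWindows {α : Type*} (u : ℕ → α) :
    map (fun p : ℕ × ℕ => wordFactor u p.1 p.2) longWindows =
      comap List.length atTop ⊓ 𝓟 (language u) := by
  apply le_antisymm
  · refine le_inf (tendsto_comap_iff.2 ?_) (le_principal_iff.2 (mem_map.2 ?_))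
    · refine tendsto_snd_longWindows.congr fun p => ?_
      simp [length_wordFactor]
    · exact Eventually.of_forall fun p => ⟨p.1, p.2, rfl⟩
  · intro s hs
    rw [mem_map, longWindows, mem_prod_iff] at hs
    obtain ⟨s₁, hs₁, s₂, hs₂, h⟩ := hs
    rw [mem_top] at hs₁
    refine mem_inf_of_inter (preimage_mem_comap hs₂) (mem_principal_self _) ?_
    rintro v ⟨hv, i, n, rfl⟩
    rw [Set.mem_preimage, length_wordFactor] at hv
    exact h (show (i, n) ∈ s₁ ×ˢ s₂ from ⟨hs₁ ▸ Set.mem_univ _, hv⟩)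

theorem hasFrequency_iff {α : Type*} [DecidableEq α] {u : ℕ → α} {w : List α} {r : ℝ} :
    HasFrequency u w r ↔ HasDensity {i | wordFactor u i w.length = w} r := by
  have hdiff : Tendsto (fun p : ℕ × ℕ => (occurrences w (wordFactor u p.1 p.2) : ℝ) /
      ((wordFactor u p.1 p.2).length : ℝ) - windowAvg {i | wordFactor u i w.length = w} p)
      longWindows (𝓝 0) := by
    refine squeeze_zero_norm' ?_ (tendsto_const_div_longWindows (w.length + 1))
    filter_upwards [tendsto_snd_longWindows.eventually_gt_atTop 0] with p hp
    obtain ⟨i, n⟩ := p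
    simp only at hp ⊢
    have hn0 : (0 : ℝ) < n := by exact_mod_cast hp
    have hs : ∑ j ∈ Finset.range n,
        ({i | wordFactor u i w.length = w} : Set ℕ).indicator (1 : ℕ → ℝ) (i + j) =
        (((Finset.range n).filter fun k => wordFactor u (i + k) w.length = w).card : ℝ) := by
      simp [Set.indicator_apply]
    rw [windowAvg, length_wordFactor, hs, ← sub_div, Real.norm_eq_abs, abs_div, abs_of_pos hn0]
    gcongr
    have ho : occurrences w (wordFactor u i n) = ((Finset.range (n + 1)).filter fun k =>
        w.length ≤ n - k ∧ wordFactor u (i + k) w.length = w).card := by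
      simp only [occurrences, length_wordFactor, drop_wordFactor, prefix_wordFactor_iff]
    rw [ho]
    -- The two counts differ at position `n`, where only the empty word is read, and at the last
    -- `w.length` positions, where `w` may overrun the window.
    have h1 : ((Finset.range (n + 1)).filter fun k =>
        w.length ≤ n - k ∧ wordFactor u (i + k) w.length = w).card ≤
        ((Finset.range n).filter fun k => wordFactor u (i + k) w.length = w).card + 1 := by
      refine (Finset.card_le_card (t := insert n ((Finset.range n).filter fun k =>
        wordFactor u (i + k) w.length = w)) ?_).trans (Finset.card_insert_le _ _)
      intro k
      simp only [Finset.mem_filter, Finset.mem_range, Finset.mem_insert]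
      rintro ⟨hk, -, hkw⟩
      rcases Nat.lt_succ_iff_lt_or_eq.1 hk with h | h
      · exact Or.inr ⟨h, hkw⟩
      · exact Or.inl h
    have h2 : ((Finset.range n).filter fun k => wordFactor u (i + k) w.length = w).card ≤
        ((Finset.range (n + 1)).filter fun k =>
        w.length ≤ n - k ∧ wordFactor u (i + k) w.length = w).card + w.length := by
      refine (Finset.card_le_card (t := ((Finset.range (n + 1)).filter fun k =>
        w.length ≤ n - k ∧ wordFactor u (i + k) w.length = w) ∪
        Finset.Ico (n - w.length) n) ?_).trans ((Finset.card_union_le _ _).trans ?_)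
      · intro k
        simp only [Finset.mem_filter, Finset.mem_range, Finset.mem_union, Finset.mem_Ico]
        rintro ⟨hk, hkw⟩
        rcases Nat.lt_or_ge k (n - w.length) with h | h
        · exact Or.inl ⟨by omega, by omega, hkw⟩
        · exact Or.inr ⟨h, hk⟩
      · rw [Nat.card_Ico]; omega
    generalize ((Finset.range (n + 1)).filter fun k =>
        w.length ≤ n - k ∧ wordFactor u (i + k) w.length = w).card = x at *
    generalize ((Finset.range n).filter fun k => wordFactor u (i + k) w.length = w).card = y at *
    have h1' : (x : ℝ) ≤ y + 1 := by exact_mod_cast h1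
    have h2' : (y : ℝ) ≤ x + w.length := by exact_mod_cast h2
    have h3 : (0 : ℝ) ≤ w.length := Nat.cast_nonneg _
    rw [abs_le]; constructor <;> linarith
  rw [HasFrequency, ← map_wordFactor_longWindows, tendsto_map'_iff, HasDensity]
  constructor
  · intro h
    simpa using h.sub hdiff
  · intro h
    have := h.add hdiff
    simpa [Function.comp_def] using this

theorem setOf_wordFactor_eq {m : ℕ} (t : ℕ → ZMod m) (x N : ℕ) :
    {i | wordFactor t i (N + 1) = wordFactor t x (N + 1)} = factorClass t N x := by
  ext i
  simp [wordFactor_eq_iff, factorClass]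

theorem frequencySet_succ {m : ℕ} (t : ℕ → ZMod m) (N : ℕ) :
    frequencySet t (N + 1) = factorDensities t N := by
  ext r
  constructor
  · rintro ⟨e, ⟨x, n, rfl⟩, hlen, hr⟩
    rw [length_wordFactor] at hlen
    subst hlen
    rw [hasFrequency_iff, length_wordFactor, setOf_wordFactor_eq] at hr
    exact ⟨x, hr⟩
  · rintro ⟨x, hr⟩
    refine ⟨_, ⟨x, N + 1, rfl⟩, length_wordFactor t x _, ?_⟩
    rwa [hasFrequency_iff, length_wordFactor, setOf_wordFactor_eq]

theorem IsThueMorse.exists_hasFrequency {b m q : ℕ} {t : ℕ → ZMod m} (h : IsThueMorse b m q t)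
    {w : List (ZMod m)} (hw : w ∈ language t) : ∃ r, HasFrequency t w r := by
  obtain ⟨x, n, rfl⟩ := hw
  simp only [hasFrequency_iff, length_wordFactor]
  rcases n with - | N
  · exact ⟨1, by simpa [wordFactor] using hasDensity_univ⟩
  · obtain ⟨r, hr⟩ := h.exists_hasDensity N x
    exact ⟨r, by rwa [setOf_wordFactor_eq]⟩

theorem IsThueMorse.hasFrequency_zero_one {b m q : ℕ} {t : ℕ → ZMod m}
    (h : IsThueMorse b m q t) :
    [0, 1] ∈ language t ∧ HasFrequency t [0, 1] (baseDensity b m q) := by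
  have hb := h.two_le
  have h1 : t 1 = 1 := by
    have := h.apply_eq 0 1 (by omega)
    simpa [h.zero] using this
  have hw : [0, 1] = wordFactor t 0 2 := by simp [wordFactor, List.range_succ, h.zero, h1]
  refine ⟨⟨0, 2, hw⟩, ?_⟩
  rw [hasFrequency_iff, hw, length_wordFactor, setOf_wordFactor_eq,
    factorClass_one (b := b) (k := 0) (by simp [h.zero, h1])]
  simpa using h.hasDensity_jumpSet (t 0) h.q_pos

end Frequencies

/-! ### Assembly of the table. -/

theorem isThueMorse_of_isFixedPointOf {b m q : ℕ} {t : ℕ → ZMod m} (hb : 2 ≤ b) (hm : 1 ≤ m)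
    (hbm : ¬ b ≡ 1 [MOD m]) (ht0 : t 0 = 0) (ht : IsFixedPointOf (thueMorseMorphism b m) t)
    (hq : IsLeast {k : ℕ | 0 < k ∧ k * (b - 1) ≡ 0 [MOD m]} q) : IsThueMorse b m q t := by
  have key : ∀ k : ℕ, k * (b - 1) ≡ 0 [MOD m] ↔ (k : ZMod m) * ((b : ZMod m) - 1) = 0 := by
    intro k
    rw [← ZMod.natCast_eq_natCast_iff, Nat.cast_mul, Nat.cast_sub (by omega)]
    simp
  refine ⟨hb, hm, ?_, (isFixedPointOf_thueMorseMorphism_iff t).1 ht, ht0, hq.1.1,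
    (key q).1 hq.1.2, fun k hk hkq h => ?_⟩
  · intro h
    apply hbm
    rw [← ZMod.natCast_eq_natCast_iff]
    simpa using h
  · have := hq.2 ⟨hk, (key k).2 h⟩
    omega

theorem eq_one_div_mul_iff {B r x : ℝ} (hB : B ≠ 0) : r = 1 / B * x ↔ B * r = x := by
  constructor
  · rintro rfl; field_simp
  · rintro rfl; field_simp

theorem exists_mem_Icc_one_iff {q : ℕ} (hq : 1 ≤ q) (P : ℕ → Prop) :
    (∃ k ∈ Finset.Icc 1 q, P k) ↔ ∃ k ∈ Finset.Icc 0 (q - 1), P (k + 1) := by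
  simp only [Finset.mem_Icc]
  constructor
  · rintro ⟨k, hk, h⟩
    exact ⟨k - 1, by omega, by rwa [Nat.sub_add_cancel hk.1]⟩
  · rintro ⟨k, hk, h⟩
    exact ⟨k + 1, by omega, h⟩

theorem exists_mem_Icc_zero_iff (q : ℕ) (P : ℕ → Prop) :
    (∃ k ∈ Finset.Icc 0 q, P k) ↔ P 0 ∨ ∃ k ∈ Finset.Icc 1 q, P k := by
  rw [← Finset.insert_Icc_succ_left_eq_Icc (Nat.zero_le q)]
  simp

theorem mainTheorem1 (b m : ℕ) (hb : 2 ≤ b) (hm : 1 ≤ m) (hbm : ¬ b ≡ 1 [MOD m])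
    (t : ℕ → ZMod m) (ht0 : t 0 = 0) (ht : IsFixedPointOf (thueMorseMorphism b m) t)
    (q : ℕ) (hq : IsLeast {k : ℕ | 0 < k ∧ k * (b - 1) ≡ 0 [MOD m]} q)
    (f : ℝ) (hf : f = (b : ℝ) ^ (q - 1) * ((b : ℝ) - 1) / ((m : ℝ) * ((b : ℝ) ^ q - 1))) :
    -- every factor has a frequency
    (∀ w ∈ language t, ∃ r : ℝ, HasFrequency t w r) ∧
    -- the frequency of the factor `01` is `f`
    ([0, 1] ∈ language t ∧ HasFrequency t [0, 1] f) ∧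
    -- the table of the sets of frequencies of the factors of length `N + 1`
    frequencySet t (0 + 1) = {1 / (m : ℝ)} ∧
    frequencySet t (1 + 1) = {r | ∃ k ∈ Finset.Icc 0 (q - 1), r = f / (b : ℝ) ^ k} ∧
    (∀ N l : ℕ, ∀ n ∈ Finset.Icc 3 b, (n - 1) * b ^ l < N → N < n * b ^ l →
      frequencySet t (N + 1) =
        {1 / (b : ℝ) ^ l * (((n : ℝ) - 1) * f - ((n : ℝ) - 2) / m),
          1 / (b : ℝ) ^ l * ((n : ℝ) * f - ((n : ℝ) - 1) / m)} ∪
        {r | ∃ k ∈ Finset.Icc 1 (q - 1), r = 1 / (b : ℝ) ^ l * (1 / (b : ℝ) ^ k * f)}) ∧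
    (∀ N l : ℕ, ∀ n ∈ Finset.Icc (b + 1) (2 * b - 1), (n - 1) * b ^ l < N → N < n * b ^ l →
      frequencySet t (N + 1) =
        {1 / (b : ℝ) ^ l * (1 / (b : ℝ) ^ (q - 1) * f - ((n : ℝ) - b - 1) / (b : ℝ) ^ q * f),
          1 / (b : ℝ) ^ l * (1 / (b : ℝ) ^ (q - 1) * f - ((n : ℝ) - b) / (b : ℝ) ^ q * f),
          1 / (b : ℝ) ^ (l + 1) * (2 * f - 1 / m)} ∪
        {r | ∃ k ∈ Finset.Icc 1 q, r = 1 / (b : ℝ) ^ l * (1 / (b : ℝ) ^ k * f)}) ∧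
    (∀ N l : ℕ, (2 * b - 1) * b ^ l < N → N < 2 * b ^ (l + 1) →
      frequencySet t (N + 1) =
        {1 / (b : ℝ) ^ (l + 1) * (2 * f - 1 / m)} ∪
        {r | ∃ k ∈ Finset.Icc 0 (q - 1), r = 1 / (b : ℝ) ^ (l + 1) * (1 / (b : ℝ) ^ k * f)}) ∧
    (∀ N l : ℕ, ∀ n ∈ Finset.Icc 2 b, N = n * b ^ l →
      frequencySet t (N + 1) =
        {1 / (b : ℝ) ^ l * ((n : ℝ) * f - ((n : ℝ) - 1) / m)} ∪
        {r | ∃ k ∈ Finset.Icc 1 (q - 1), r = 1 / (b : ℝ) ^ l * (f / (b : ℝ) ^ k)}) ∧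
    (∀ N l : ℕ, ∀ n ∈ Finset.Icc (b + 1) (2 * b - 1), N = n * b ^ l →
      frequencySet t (N + 1) =
        {1 / (b : ℝ) ^ l * (1 / (b : ℝ) ^ (q - 1) * f - ((n : ℝ) - b) / (b : ℝ) ^ q * f),
          1 / (b : ℝ) ^ (l + 1) * (2 * f - 1 / m)} ∪
        {r | ∃ k ∈ Finset.Icc 1 q, r = 1 / (b : ℝ) ^ l * (1 / (b : ℝ) ^ k * f)}) := by
  have h := isThueMorse_of_isFixedPointOf hb hm hbm ht0 ht hq
  have hf' : f = baseDensity b m q := hf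
  have hb0 := h.cast_pos
  have hb0' : (b : ℝ) ≠ 0 := hb0.ne'
  have hbl : ∀ l : ℕ, (b : ℝ) ^ l ≠ 0 := fun l => pow_ne_zero _ hb0.ne'
  have hq2 := h.two_le_q
  -- The two formulas for the density of a run agree at `N = b`; this is needed when `n = b + 1`,
  -- whose lower endpoint `b` belongs to the first range.
  have hf1 : 1 / (b : ℝ) ^ (q - 1) * f = b * f - (b - 1) / m := by
    have := baseDensity_eq (b := b) (m := m) hb hm h.q_pos
    rw [← hf'] at this
    rw [one_div_mul_eq_div]
    generalize f / (b : ℝ) ^ (q - 1) = g at *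
    have hm0 : (m : ℝ) ≠ 0 := by exact_mod_cast h.pos.ne'
    field_simp at this ⊢
    linear_combination -this
  have hle : ∀ N, 1 ≤ N → N ≤ b → ∀ r, r ∈ factorDensities t N ↔ r = N * f - (N - 1) / m ∨
      ∃ k ∈ Finset.Icc 1 (q - 1), r = f / (b : ℝ) ^ k :=
    fun N h1 h2 r => hf' ▸ h.mem_factorDensities_of_le h1 h2
  have hge : ∀ N, b + 1 ≤ N → N ≤ 2 * b - 1 → ∀ r, r ∈ factorDensities t N ↔
      r = 1 / (b : ℝ) ^ (q - 1) * f - (N - b) / (b : ℝ) ^ q * f ∨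
      r = (2 * f - 1 / m) / b ∨ ∃ k ∈ Finset.Icc 1 q, r = f / (b : ℝ) ^ k :=
    fun N h1 h2 r => hf' ▸ h.mem_factorDensities_of_ge h1 h2
  have hs : ∀ (l : ℕ) (r x : ℝ), r = 1 / (b : ℝ) ^ (l + 1) * x ↔ (b : ℝ) ^ l * r = x / b := by
    intro l r x
    rw [eq_one_div_mul_iff (hbl _), pow_succ, eq_div_iff hb0']
    constructor <;> intro h' <;> linear_combination h'
  have hsk : ∀ k : ℕ, 1 / (b : ℝ) ^ k * f / b = f / (b : ℝ) ^ (k + 1) := by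
    intro k; rw [one_div_mul_eq_div, div_div, pow_succ]
  refine ⟨fun w hw => h.exists_hasFrequency hw, hf' ▸ h.hasFrequency_zero_one, ?_⟩
  simp only [frequencySet_succ]
  refine ⟨?_, ?_, ?_, ?_, ?_, ?_, ?_⟩
  · ext r
    rw [Set.mem_singleton_iff]
    constructor
    · rintro ⟨x, hx⟩
      rw [IsThueMorse.factorClass_zero] at hx
      exact hx.unique (h.hasDensity_letter _)
    · rintro rfl
      exact ⟨0, IsThueMorse.factorClass_zero (t := t) 0 ▸ h.hasDensity_letter _⟩
  · ext r
    rw [hle 1 le_rfl (by omega), Set.mem_ofPred_eq, exists_mem_Icc_zero_iff]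
    simp
  · intro N l n hn h1 h2
    rw [Finset.mem_Icc] at hn
    ext r
    rw [h.mem_factorDensities_between hn.1 l h1 h2, hle _ (by omega) (by omega),
      hle _ (by omega) (by omega), Nat.cast_sub (by omega)]
    simp only [Set.mem_union, Set.mem_insert_iff, Set.mem_singleton_iff, Set.mem_ofPred_eq,
      eq_one_div_mul_iff (hbl l)]
    simp only [one_div_mul_eq_div, Nat.cast_one, sub_sub, one_add_one_eq_two]
    clear * -
    tauto
  · intro N l n hn h1 h2
    rw [Finset.mem_Icc] at hn
    ext r
    rw [h.mem_factorDensities_between (by omega) l h1 h2, hge n (by omega) (by omega)]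
    simp only [Set.mem_union, Set.mem_insert_iff, Set.mem_singleton_iff, Set.mem_ofPred_eq,
      eq_one_div_mul_iff (hbl l), hs]
    simp only [one_div_mul_eq_div (_ ^ _) f]
    generalize (b : ℝ) ^ l * r = s
    rcases hn.1.eq_or_lt with rfl | hn'
    · rw [Nat.add_sub_cancel, hle b (by omega) le_rfl]
      rw [one_div_mul_eq_div] at hf1
      have hmono : (∃ k ∈ Finset.Icc 1 (q - 1), s = f / (b : ℝ) ^ k) →
          ∃ k ∈ Finset.Icc 1 q, s = f / (b : ℝ) ^ k := by
        rintro ⟨k, hk, e⟩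
        rw [Finset.mem_Icc] at hk
        exact ⟨k, Finset.mem_Icc.2 (by omega), e⟩
      have e : f / (b : ℝ) ^ (q - 1) - (((b + 1 : ℕ) : ℝ) - b - 1) / (b : ℝ) ^ q * f =
          b * f - (b - 1) / m := by rw [← hf1]; push_cast; ring
      rw [e]
      generalize (∃ k ∈ Finset.Icc 1 (q - 1), s = f / (b : ℝ) ^ k) = P at *
      generalize (∃ k ∈ Finset.Icc 1 q, s = f / (b : ℝ) ^ k) = Q at *
      clear * - hmono
      tauto
    · rw [hge _ (by omega) (by omega), Nat.cast_sub (by omega)]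
      simp only [one_div_mul_eq_div (_ ^ _) f]
      rw [show (n : ℝ) - (1 : ℕ) - b = n - b - 1 by push_cast; ring]
      clear * -
      tauto
  · intro N l h1 h2
    -- This row is the interval between `2 * b - 1` and `2 * b` at level `l`; its right endpoint is
    -- `n = 2` one level up.
    have e2 : 2 * b ^ (l + 1) = 2 * b * b ^ l := by ring
    rw [e2] at h2
    ext r
    have h4 := h.mem_factorDensities_mul_pow (n := 2) le_rfl 1 (r := (b : ℝ) ^ l * r)
    simp only [pow_one] at h4
    rw [h.mem_factorDensities_between (by omega) l h1 h2, h4, hge _ (by omega) le_rfl,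
      hle 2 (by omega) hb]
    simp only [Set.mem_union, Set.mem_singleton_iff, Set.mem_ofPred_eq, hs, hsk]
    generalize (b : ℝ) ^ l * r = s
    rw [← exists_mem_Icc_one_iff (by omega) fun k => s = f / (b : ℝ) ^ k]
    -- For `N = 2 * b - 1` the run density is already one of the values `f / b ^ k`, so it does not
    -- appear separately.
    have hz : 1 / (b : ℝ) ^ (q - 1) * f - (((2 * b - 1 : ℕ) : ℝ) - b) / (b : ℝ) ^ q * f =
        f / (b : ℝ) ^ q := by
      rw [Nat.cast_sub (by omega)]
      obtain ⟨q', rfl⟩ := Nat.exists_eq_succ_of_ne_zero h.q_pos.ne'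
      simp only [Nat.succ_eq_add_one, Nat.add_sub_cancel, pow_succ]
      push_cast
      field_simp
      ring
    rw [hz]
    have hq' : s = f / (b : ℝ) ^ q → ∃ k ∈ Finset.Icc 1 q, s = f / (b : ℝ) ^ k :=
      fun e => ⟨q, Finset.mem_Icc.2 (by omega), e⟩
    have hk' : (∃ k ∈ Finset.Icc 1 (q - 1), b * s = f / (b : ℝ) ^ k) →
        ∃ k ∈ Finset.Icc 1 q, s = f / (b : ℝ) ^ k := by
      rintro ⟨k, hk, e⟩
      rw [Finset.mem_Icc] at hk
      refine ⟨k + 1, Finset.mem_Icc.2 (by omega), ?_⟩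
      rw [pow_succ, ← div_div, ← e]; field_simp
    have h2' : (b : ℝ) * s = ((2 : ℕ) : ℝ) * f - (((2 : ℕ) : ℝ) - 1) / m ↔
        s = (2 * f - 1 / m) / b := by
      rw [eq_div_iff hb0', mul_comm s]; norm_num
    rw [h2']
    generalize (∃ k ∈ Finset.Icc 1 (q - 1), b * s = f / (b : ℝ) ^ k) = P at *
    generalize (∃ k ∈ Finset.Icc 1 q, s = f / (b : ℝ) ^ k) = Q at *
    clear * - hq' hk'
    tauto
  · rintro N l n hn rfl
    rw [Finset.mem_Icc] at hn
    ext r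
    rw [h.mem_factorDensities_mul_pow hn.1, hle n (by omega) hn.2]
    simp only [Set.mem_union, Set.mem_singleton_iff, Set.mem_ofPred_eq, eq_one_div_mul_iff (hbl l)]
  · rintro N l n hn rfl
    rw [Finset.mem_Icc] at hn
    ext r
    rw [h.mem_factorDensities_mul_pow (by omega), hge n hn.1 hn.2]
    simp only [Set.mem_union, Set.mem_insert_iff, Set.mem_singleton_iff, Set.mem_ofPred_eq,
      eq_one_div_mul_iff (hbl l), hs]
    simp only [one_div_mul_eq_div (_ ^ _) f, or_assoc]
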